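/- Let $d\ge 1$ and let $\boldsymbol X_1,\boldsymbol X_2,\dots$ be i.i.d. random vectors with values in $[0,\infty)^d$ and distribution function $F$. Assume that $F$ is twice continuously differentiable on $(0,\infty)^d$ and that for every compact $S\subset(0,\infty)^d$ there are $\delta_S>0$ and $M_S<\infty$ with $|\partial_{x_i}F(\boldsymbol y)|\le M_S$ and $|\partial^2_{x_ix_j}F(\boldsymbol y)|\le M_S$ for all $i,j$ and all $\boldsymbol y\in(0,\infty)^d$ at $\ell^1$-distance at most $\delta_S$ from some point of $S$. Let $F_n(\boldsymbol x)=\frac1n\sum_{i=1}^n \mathbb I\{\boldsymbol X_i\le \boldsymbol x\}$ (coordinatewise inequality) be the empirical distribution function and, for a real $m>0$ (in particular for a positive integer $m$), let $$F_{m,n}(\boldsymbol x)=\sum_{\boldsymbol k\in\mathbb N_0^d}F_n\Big(\frac{k_1}{m},\dots,\frac{k_d}{m}\Big)\prod_{j=1}^d e^{-mx_j}\frac{(mx_j)^{k_j}}{k_j!}$$ be the Szász–Mirakyan estimator with isotropic smoothing level $m$. For $S\subset(0,\infty)^d$ and a random function $\widehat F$ put $\mathrm{IMSE}_S(\widehat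 F)=\mathbb E\int_S\{\widehat F(\boldsymbol x)-F(\boldsymbol x)\}^2\,\mathrm d\boldsymbol x$. Put $$\sigma^2(\boldsymbol x)=F(\boldsymbol x)\{1-F(\boldsymbol x)\},\quad V(\boldsymbol x)=\sum_{j=1}^d\partial_{x_j}F(\boldsymbol x)\sqrt{x_j/\pi},\quad B(\boldsymbol x)=\frac12\sum_{j=1}^d x_j\,\partial^2_{x_jx_j}F(\boldsymbol x).$$ Then for every compact $S\subset(0,\infty)^d$, as $n\to\infty$ and $m\to\infty$ (independently of each other), $$\mathrm{IMSE}_S(F_{m,n})=n^{-1}\int_S\sigma^2-n^{-1}m^{-1/2}\int_SV+m^{-2}\int_SB^2+o(n^{-1}m^{-1/2})+o(m^{-2}),$$ while $\mathrm{IMSE}_S(F_n)=n^{-1}\int_S\sigma^2$ for all $n\ge1$. If moreover $\int_SB^2>0$, then $\int_SV>0$, and $$m_{\mathrm{opt}}=m_{\mathrm{opt}}(n)=n^{2/3}\left[\frac{4\int_SB^2}{\int_SV}\right]^{2/3}$$ is the asymptotically optimal choice of $m$ with respect to $\mathrm{IMSE}_S$, in the following sense. For every $n\ge1$, $m_{\mathrm{opt}}(n)$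 is the unique minimiser over $m>0$ of $n^{-1}\int_S\sigma^2-n^{-1}m^{-1/2}\int_SV+m^{-2}\int_SB^2$. For every sequence $m_n\to\infty$ and every $\varepsilon>0$, $\mathrm{IMSE}_S(F_{m_{\mathrm{opt}},n})\le \mathrm{IMSE}_S(F_{m_n,n})+\varepsilon n^{-4/3}$ for all large $n$. And for every sequence $m_n\to\infty$, $\mathrm{IMSE}_S(F_{m_n,n})-\mathrm{IMSE}_S(F_{m_{\mathrm{opt}},n})=o(n^{-4/3})$ if and only if $m_n/m_{\mathrm{opt}}(n)\to1$ (so $m_{\mathrm{opt}}$ may be rounded to an integer). With this choice, as $n\to\infty$, $$\mathrm{IMSE}_S(F_{m_{\mathrm{opt}},n})=n^{-1}\int_S\sigma^2-n^{-4/3}\,\frac34\left[\frac{\{\int_SV\}^4}{4\int_SB^2}\right]^{1/3}+o(n^{-4/3}).$$ -/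

import Mathlib

open MeasureTheory ProbabilityTheory Filter Asymptotics Topology

noncomputable section

namespace SzaszMirakyan

/-- The open orthant `(0,∞)^d`. -/
def openOrthant (d : ℕ) : Set (Fin d → ℝ) := {x | ∀ j, 0 < x j}

/-- The distribution function `F(x) = μ {y | y ≤ x coordinatewise}` of a law `μ` on `ℝ^d`. -/
def jointCDF {d : ℕ} (μ : Measure (Fin d → ℝ)) (x : Fin d → ℝ) : ℝ :=
  μ.real (Set.Iic x)

/-- The partial derivative `∂_{x_i} G (x)`. -/
def partialDeriv {d : ℕ} (i : Fin d) (G : (Fin d → ℝ) → ℝ) (x : Fin d → ℝ) : ℝ :=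
  lineDeriv ℝ G x (Pi.single i 1)

/-- The `ℓ¹`-neighbourhood `{y ∈ (0,∞)^d : ∃ z ∈ S, ‖y - z‖₁ ≤ δ}`. -/
def l1Nhd {d : ℕ} (δ : ℝ) (S : Set (Fin d → ℝ)) : Set (Fin d → ℝ) :=
  {y | y ∈ openOrthant d ∧ ∃ z ∈ S, ∑ j, |y j - z j| ≤ δ}

/-- `F` is twice continuously differentiable on `(0,∞)^d`, and its partial derivatives of the
first two orders are bounded on an `ℓ¹`-neighbourhood of each compact subset of `(0,∞)^d`. -/
structure InteriorC2 {d : ℕ} (F : (Fin d → ℝ) → ℝ) : Prop where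
  contDiffOn : ContDiffOn ℝ 2 F (openOrthant d)
  bounded : ∀ S : Set (Fin d → ℝ), IsCompact S → S ⊆ openOrthant d →
    ∃ δ > 0, ∃ M : ℝ, ∀ y ∈ l1Nhd δ S,
      (∀ i, |partialDeriv i F y| ≤ M) ∧
      (∀ i j, |partialDeriv i (partialDeriv j F) y| ≤ M)

/-- The product Poisson weights `P_{k,m}(x)`. -/
def poissonWeight {d : ℕ} (k : Fin d → ℕ) (m x : Fin d → ℝ) : ℝ :=
  ∏ j, (Real.exp (-(m j * x j)) * (m j * x j) ^ k j / ((k j).factorial : ℝ))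

/-- The empirical distribution function of the first `n` observations `X 0, …, X (n-1)`. -/
def empiricalCDF {d : ℕ} {Ω : Type*} (X : ℕ → Ω → Fin d → ℝ) (n : ℕ) (ω : Ω)
    (x : Fin d → ℝ) : ℝ :=
  (1 / (n : ℝ)) * ∑ i ∈ Finset.range n, (Set.Iic x).indicator (fun _ => (1 : ℝ)) (X i ω)

/-- The Szász–Mirakyan estimator `F_{m,n}(x) = ∑_{k ∈ ℕ₀^d} F_n(k/m) P_{k,m}(x)`. The smoothing
parameters are positive reals, positive integers being a special case. -/
def estimator {d : ℕ} {Ω : Type*} (X : ℕ → Ω → Fin d → ℝ) (m : Fin d → ℝ) (n : ℕ) (ω : Ω)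
    (x : Fin d → ℝ) : ℝ :=
  ∑' k : Fin d → ℕ, empiricalCDF X n ω (fun j => (k j : ℝ) / m j) * poissonWeight k m x

/-- The integrated mean squared error `E ∫_S (G(x) - F(x))² dx` of a random function `G`. -/
def IMSE {d : ℕ} {Ω : Type*} [MeasurableSpace Ω] (P : Measure Ω) (S : Set (Fin d → ℝ))
    (F : (Fin d → ℝ) → ℝ) (G : Ω → (Fin d → ℝ) → ℝ) : ℝ :=
  ∫ ω, (∫ x in S, (G ω x - F x) ^ 2) ∂P

/-- `σ²(x) = F(x) (1 - F(x))`. -/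
def sigmaSq {d : ℕ} (F : (Fin d → ℝ) → ℝ) (x : Fin d → ℝ) : ℝ := F x * (1 - F x)

/-- `V(x) = ∑_j ∂_{x_j} F(x) √(x_j / π)`. -/
def V {d : ℕ} (F : (Fin d → ℝ) → ℝ) (x : Fin d → ℝ) : ℝ :=
  ∑ j, partialDeriv j F x * Real.sqrt (x j / Real.pi)

/-- `B(x) = (1/2) ∑_j x_j ∂²_{x_j x_j} F(x)`. -/
def B {d : ℕ} (F : (Fin d → ℝ) → ℝ) (x : Fin d → ℝ) : ℝ :=
  (1 / 2) * ∑ j, x j * partialDeriv j (partialDeriv j F) x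

/-- The leading terms `n⁻¹ ∫σ² - n⁻¹ m^{-1/2} ∫V + m⁻² ∫B²` of the integrated MSE. -/
def leadingIMSE {d : ℕ} (F : (Fin d → ℝ) → ℝ) (S : Set (Fin d → ℝ)) (n : ℕ) (m : ℝ) : ℝ :=
  (n : ℝ)⁻¹ * (∫ x in S, sigmaSq F x)
    - (n : ℝ)⁻¹ * m ^ (-(1 / 2) : ℝ) * (∫ x in S, V F x)
    + m ^ (-2 : ℝ) * (∫ x in S, B F x ^ 2)

/-- `m_opt(n) = n^{2/3} [4 ∫B² / ∫V]^{2/3}`. -/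
def mOpt {d : ℕ} (F : (Fin d → ℝ) → ℝ) (S : Set (Fin d → ℝ)) (n : ℕ) : ℝ :=
  (n : ℝ) ^ (2 / 3 : ℝ) * ((4 * ∫ x in S, B F x ^ 2) / ∫ x in S, V F x) ^ (2 / 3 : ℝ)

end SzaszMirakyan

end

noncomputable section

namespace SzaszMirakyan

open scoped NNReal BoundedContinuousFunction

/-! The weights at `x` are the probabilities P(K = k) for a vector K of independent Poisson
variables with means m x_j. So the estimator is the sample mean of g(x, X_i), where g(x, y) = P(y ≤
K/m) is `smoothIndicator`. Fubini and the bias-variance identity then give, exactly, IMSE = n⁻¹ A(m)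
+ C(m) with A = `varianceTerm` and C = `biasTerm`. Neither depends on n, which is why n and m may
grow independently.

Integrating out y, E g = E F(K/m) and, with an independent copy K', E g² = E F(min(K, K')/m). Since
K/m has mean x and covariance diag(x_j/m), a second-order Taylor expansion gives the bias B/m +
o(1/m) (`eventually_abs_bias_sub_le`). For the second moment first order suffices: min(a, b) = (a +
b)/2 - |a - b|/2 yields E min(K_j, K'_j)/m - x_j = -E|K_j - K'_j|/(2m), and the central limit
theorem yields E|K_j - K'_j| ~ 2√(m x_j/π). This is the source of -V/√m
(`eventually_abs_second_moment_sub_le`). All estimates are uniform on S; as F is bounded, points far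
from x are absorbed by a power of the distance.

With v = ∫V, b = ∫B² and s = n^{1/3} m^{-1/2}, the leading terms minus n⁻¹∫σ² equal n^{-4/3}(-v s +
b s⁴). The minimiser s₀ satisfies v = 4 b s₀³, and the excess risk is at least 3 b s₀² (s - s₀)².
The remainder is at most ε(s + s⁴), which coercivity bounds by half the excess plus a small
constant, so arbitrary sequences m_n → ∞ can be compared (`optimal_tuning`). Finally ∫B² > 0 forces
∫V > 0, because B vanishes wherever the nonnegative V does. -/

theorem integrable_fun_sub {α : Type*} [MeasurableSpace α] {μ : Measure α} {f g : α → ℝ}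
    (hf : Integrable f μ) (hg : Integrable g μ) : Integrable (fun x => f x - g x) μ := hf.sub hg

/-! ### Elementary properties of the distribution function -/

theorem measurable_indicator_Iic {d : ℕ} :
    Measurable (fun p : (Fin d → ℝ) × (Fin d → ℝ) =>
      (Set.Iic p.1).indicator (fun _ => (1 : ℝ)) p.2) := by
  have h : MeasurableSet {p : (Fin d → ℝ) × (Fin d → ℝ) | p.2 ≤ p.1} :=
    (isClosed_le continuous_snd continuous_fst).measurableSet
  exact (measurable_const.indicator h : Measurable
    ({p : (Fin d → ℝ) × (Fin d → ℝ) | p.2 ≤ p.1}.indicator fun _ => (1 : ℝ)))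

theorem jointCDF_eq_integral {d : ℕ} (μ : Measure (Fin d → ℝ)) (x : Fin d → ℝ) :
    jointCDF μ x = ∫ y, (Set.Iic x).indicator (fun _ => (1 : ℝ)) y ∂μ := by
  rw [integral_indicator measurableSet_Iic]
  simp [jointCDF]

theorem measurable_jointCDF {d : ℕ} (μ : Measure (Fin d → ℝ)) [SFinite μ] :
    Measurable (jointCDF μ) := by
  rw [funext (jointCDF_eq_integral μ)]
  exact measurable_indicator_Iic.stronglyMeasurable.integral_prod_right.measurable

theorem jointCDF_nonneg {d : ℕ} (μ : Measure (Fin d → ℝ)) (x : Fin d → ℝ) : 0 ≤ jointCDF μ x :=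
  measureReal_nonneg

theorem jointCDF_le_one {d : ℕ} (μ : Measure (Fin d → ℝ)) [IsProbabilityMeasure μ]
    (x : Fin d → ℝ) : jointCDF μ x ≤ 1 := measureReal_le_one

theorem jointCDF_mono {d : ℕ} (μ : Measure (Fin d → ℝ)) [IsProbabilityMeasure μ] :
    Monotone (jointCDF μ) := fun _ _ h => measureReal_mono (Set.Iic_subset_Iic.2 h)

theorem IMSE_congr {d : ℕ} {Ω : Type*} [MeasurableSpace Ω] (P : Measure Ω) {S : Set (Fin d → ℝ)}
    (hS : MeasurableSet S) (F : (Fin d → ℝ) → ℝ) {G G' : Ω → (Fin d → ℝ) → ℝ}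
    (h : ∀ ω, ∀ x ∈ S, G ω x = G' ω x) : IMSE P S F G = IMSE P S F G' := by
  unfold IMSE
  congr 1 with ω
  exact setIntegral_congr_fun hS fun x hx => by simp only [h ω x hx]

/-! ### Mean squared error of sample means -/

section SampleMean

variable {E Ω : Type*} [MeasurableSpace E] [MeasurableSpace Ω] {P : Measure Ω}
  [IsProbabilityMeasure P] {μ : Measure E} {X : ℕ → Ω → E}

/-- Bias-variance decomposition of the mean squared error of a sample mean. -/
theorem integral_sq_sampleMean_sub (hlaw : ∀ i, HasLaw (X i) μ P) (hindep : iIndepFun X P)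
    {h : E → ℝ} (hh : Measurable h) (h0 : ∀ y, 0 ≤ h y) (h1 : ∀ y, h y ≤ 1) (c : ℝ)
    {n : ℕ} (hn : 0 < n) :
    ∫ ω, ((1 / (n : ℝ)) * ∑ i ∈ Finset.range n, h (X i ω) - c) ^ 2 ∂P
      = (n : ℝ)⁻¹ * (∫ y, h y ^ 2 ∂μ - (∫ y, h y ∂μ) ^ 2) + (∫ y, h y ∂μ - c) ^ 2 := by
  have hn' : (n : ℝ) ≠ 0 := by positivity
  have hLX : ∀ i, MemLp (fun ω => h (X i ω)) 2 P := fun i =>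
    MemLp.of_bound (hh.comp_aemeasurable (hlaw i).aemeasurable).aestronglyMeasurable 1
      (ae_of_all _ fun ω => by rw [Real.norm_of_nonneg (h0 _)]; exact h1 _)
  have hmean : ∀ i, ∫ ω, h (X i ω) ∂P = ∫ y, h y ∂μ := fun i =>
    (hlaw i).integral_comp hh.aestronglyMeasurable
  have hsq : ∀ i, ∫ ω, h (X i ω) ^ 2 ∂P = ∫ y, h y ^ 2 ∂μ := fun i =>
    (hlaw i).integral_comp (f := fun y => h y ^ 2) (hh.pow_const 2).aestronglyMeasurable
  have hvar : ∀ i, variance (fun ω => h (X i ω)) P = ∫ y, h y ^ 2 ∂μ - (∫ y, h y ∂μ) ^ 2 := by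
    intro i
    rw [variance_eq_sub (hLX i), hmean i]
    congr 1
    exact hsq i
  set Z : Ω → ℝ := ∑ i ∈ Finset.range n, fun ω => h (X i ω) with hZ
  have hZL : MemLp Z 2 P := memLp_finsetSum' _ fun i _ => hLX i
  have hvarZ : variance Z P = n * (∫ y, h y ^ 2 ∂μ - (∫ y, h y ∂μ) ^ 2) := by
    rw [hZ, IndepFun.variance_sum (fun i _ => hLX i)
      (fun i _ j _ hij => (hindep.indepFun hij).comp hh hh)]
    simp only [hvar, Finset.sum_const, Finset.card_range, nsmul_eq_mul]
  have hmeanZ : ∫ ω, Z ω ∂P = n * ∫ y, h y ∂μ := by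
    simp only [hZ, Finset.sum_apply]
    rw [integral_finsetSum _ fun i _ => (hLX i).integrable (by norm_num)]
    simp [hmean]
  have hvarZ' := variance_eq_sub hZL
  have hZsq : ∫ ω, Z ω ^ 2 ∂P = n * (∫ y, h y ^ 2 ∂μ - (∫ y, h y ∂μ) ^ 2)
      + (n * ∫ y, h y ∂μ) ^ 2 := by
    have : ∫ ω, (Z ^ 2) ω ∂P = ∫ ω, Z ω ^ 2 ∂P := rfl
    rw [hmeanZ, hvarZ, this] at hvarZ'
    linarith
  have hexp : ∀ ω, ((1 / (n : ℝ)) * ∑ i ∈ Finset.range n, h (X i ω) - c) ^ 2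
      = (1 / (n : ℝ)) ^ 2 * Z ω ^ 2 - 2 * c * (1 / n) * Z ω + c ^ 2 := by
    intro ω
    simp only [hZ, Finset.sum_apply]
    ring
  simp_rw [hexp]
  have i1 : Integrable (fun ω => (1 / (n : ℝ)) ^ 2 * Z ω ^ 2) P := hZL.integrable_sq.const_mul _
  have i2 : Integrable (fun ω => 2 * c * (1 / n) * Z ω) P :=
    (hZL.integrable (by norm_num)).const_mul _
  rw [integral_add (integrable_fun_sub i1 i2) (integrable_const _), integral_sub i1 i2, integral_const_mul,
    integral_const_mul, hmeanZ, hZsq]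
  simp only [integral_const, probReal_univ, smul_eq_mul]
  field_simp
  ring

end SampleMean

/-- Fubini reduces the claim to the pointwise bias-variance identity. It serves twice: with the
indicator of `Set.Iic x` for the empirical distribution function, and with `smoothIndicator` for the
smoothed one. -/
theorem IMSE_sampleMean {d : ℕ} {Ω : Type*} [MeasurableSpace Ω] {P : Measure Ω}
    [IsProbabilityMeasure P] {μ : Measure (Fin d → ℝ)} [IsProbabilityMeasure μ]
    {X : ℕ → Ω → Fin d → ℝ} (hlaw : ∀ i, HasLaw (X i) μ P) (hindep : iIndepFun X P)
    {S : Set (Fin d → ℝ)} (hS : IsCompact S) {F : (Fin d → ℝ) → ℝ} (hF : Measurable F)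
    (hF0 : ∀ x, 0 ≤ F x) (hF1 : ∀ x, F x ≤ 1)
    {g : (Fin d → ℝ) → (Fin d → ℝ) → ℝ} (hg : Measurable (Function.uncurry g))
    (hg0 : ∀ x y, 0 ≤ g x y) (hg1 : ∀ x y, g x y ≤ 1) {n : ℕ} (hn : 0 < n) :
    IMSE P S F (fun ω x => (1 / (n : ℝ)) * ∑ i ∈ Finset.range n, g x (X i ω))
      = (n : ℝ)⁻¹ * (∫ x in S, (∫ y, g x y ^ 2 ∂μ - (∫ y, g x y ∂μ) ^ 2))
        + ∫ x in S, (∫ y, g x y ∂μ - F x) ^ 2 := by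
  have : IsFiniteMeasure (volume.restrict S) := ⟨by simpa using hS.measure_lt_top⟩
  have hn' : (0 : ℝ) < n := by positivity
  have hmeas : AEMeasurable (Function.uncurry fun (ω : Ω) (x : Fin d → ℝ) =>
      ((1 / (n : ℝ)) * ∑ i ∈ Finset.range n, g x (X i ω) - F x) ^ 2)
      (P.prod (volume.restrict S)) := by
    have hX : ∀ i, AEMeasurable (fun p : Ω × (Fin d → ℝ) => g p.2 (X i p.1))
        (P.prod (volume.restrict S)) := fun i =>
      hg.comp_aemeasurable (measurable_snd.aemeasurable.prodMk
        ((hlaw i).aemeasurable.comp_quasiMeasurePreserving Measure.quasiMeasurePreserving_fst))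
    exact (((Finset.aemeasurable_fun_sum _ fun i _ => hX i).const_mul _).sub
      (hF.comp measurable_snd).aemeasurable).pow_const 2
  have hint : Integrable (Function.uncurry fun (ω : Ω) (x : Fin d → ℝ) =>
      ((1 / (n : ℝ)) * ∑ i ∈ Finset.range n, g x (X i ω) - F x) ^ 2)
      (P.prod (volume.restrict S)) := by
    refine Integrable.of_bound hmeas.aestronglyMeasurable 1 (ae_of_all _ fun p => ?_)
    have h0 : 0 ≤ (1 / (n : ℝ)) * ∑ i ∈ Finset.range n, g p.2 (X i p.1) :=
      mul_nonneg (by positivity) (Finset.sum_nonneg fun i _ => hg0 _ _)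
    have h1 : (1 / (n : ℝ)) * ∑ i ∈ Finset.range n, g p.2 (X i p.1) ≤ 1 := by
      rw [one_div, inv_mul_le_iff₀ hn', mul_one]
      simpa using Finset.sum_le_card_nsmul (Finset.range n) (fun i => g p.2 (X i p.1)) 1
        fun i _ => hg1 _ _
    simp only [Function.uncurry]
    rw [norm_pow, sq_le_one_iff₀ (norm_nonneg _), Real.norm_eq_abs, abs_le]
    constructor <;> linarith [hF0 p.2, hF1 p.2]
  have hm1 : Measurable fun x => ∫ y, g x y ∂μ :=
    hg.stronglyMeasurable.integral_prod_right.measurable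
  have hm2 : Measurable fun x => ∫ y, g x y ^ 2 ∂μ :=
    (hg.pow_const 2).stronglyMeasurable.integral_prod_right.measurable
  have hb0 : ∀ x, 0 ≤ ∫ y, g x y ∂μ := fun x => integral_nonneg (hg0 x)
  have hgi : ∀ x, Integrable (g x) μ := fun x =>
    Integrable.of_bound (hg.of_uncurry_left).aestronglyMeasurable 1 (ae_of_all _ fun y => by
      rw [Real.norm_of_nonneg (hg0 x y)]; exact hg1 x y)
  have hb1 : ∀ x, ∫ y, g x y ∂μ ≤ 1 := fun x => by
    simpa using integral_mono (hgi x) (integrable_const (μ := μ) (1 : ℝ)) (hg1 x)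
  have hgi2 : ∀ x, Integrable (fun y => g x y ^ 2) μ := fun x =>
    Integrable.of_bound ((hg.of_uncurry_left).pow_const 2).aestronglyMeasurable 1
      (ae_of_all _ fun y => by
        rw [norm_pow, sq_le_one_iff₀ (norm_nonneg _), Real.norm_of_nonneg (hg0 x y)]
        exact hg1 x y)
  have hc0 : ∀ x, 0 ≤ ∫ y, g x y ^ 2 ∂μ := fun x => integral_nonneg fun y => sq_nonneg _
  have hc1 : ∀ x, ∫ y, g x y ^ 2 ∂μ ≤ 1 := fun x => by
    simpa using integral_mono (hgi2 x) (integrable_const (μ := μ) (1 : ℝ))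
      (fun y => pow_le_one₀ (hg0 x y) (hg1 x y))
  have I1 : Integrable (fun x => ∫ y, g x y ^ 2 ∂μ - (∫ y, g x y ∂μ) ^ 2)
      (volume.restrict S) := by
    refine Integrable.of_bound (hm2.sub (hm1.pow_const 2)).aestronglyMeasurable 1
      (ae_of_all _ fun x => ?_)
    rw [Real.norm_eq_abs, abs_le]
    have := pow_le_one₀ (n := 2) (hb0 x) (hb1 x)
    have := sq_nonneg (∫ y, g x y ∂μ)
    constructor <;> linarith [hc0 x, hc1 x]
  have I2 : Integrable (fun x => (∫ y, g x y ∂μ - F x) ^ 2) (volume.restrict S) := by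
    refine Integrable.of_bound ((hm1.sub hF).pow_const 2).aestronglyMeasurable 1
      (ae_of_all _ fun x => ?_)
    rw [norm_pow, sq_le_one_iff₀ (norm_nonneg _), Real.norm_eq_abs, abs_le]
    constructor <;> linarith [hF0 x, hF1 x, hb0 x, hb1 x]
  unfold IMSE
  rw [integral_integral_swap hint, ← integral_const_mul, ← integral_add (I1.const_mul _) I2]
  congr 1 with x
  exact integral_sq_sampleMean_sub hlaw hindep hg.of_uncurry_left (hg0 x) (hg1 x) (F x) hn

/-- An indicator equals its own square and has mean F(x), so the bias vanishes and the variance is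
F(1 - F). -/
theorem IMSE_empiricalCDF {d : ℕ} {Ω : Type*} [MeasurableSpace Ω] {P : Measure Ω}
    [IsProbabilityMeasure P] {μ : Measure (Fin d → ℝ)} [IsProbabilityMeasure μ]
    {X : ℕ → Ω → Fin d → ℝ} (hlaw : ∀ i, HasLaw (X i) μ P) (hindep : iIndepFun X P)
    {S : Set (Fin d → ℝ)} (hS : IsCompact S) {n : ℕ} (hn : 0 < n) :
    IMSE P S (jointCDF μ) (empiricalCDF X n)
      = (n : ℝ)⁻¹ * ∫ x in S, sigmaSq (jointCDF μ) x := by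
  have hsq : ∀ x y : Fin d → ℝ, (Set.Iic x).indicator (fun _ => (1 : ℝ)) y ^ 2
      = (Set.Iic x).indicator (fun _ => (1 : ℝ)) y := by
    intro x y
    by_cases h : y ∈ Set.Iic x <;> simp [h]
  have := IMSE_sampleMean hlaw hindep hS (measurable_jointCDF μ) (jointCDF_nonneg μ)
    (jointCDF_le_one μ) (g := fun x y => (Set.Iic x).indicator (fun _ => (1 : ℝ)) y)
    measurable_indicator_Iic
    (fun x y => Set.indicator_nonneg (fun _ _ => zero_le_one) _)
    (fun x y => Set.indicator_le_self' (fun _ _ => zero_le_one) _) hn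
  refine Eq.trans this ?_
  simp only [hsq, ← jointCDF_eq_integral]
  simp only [sub_self, ne_eq, OfNat.ofNat_ne_zero, not_false_eq_true, zero_pow, integral_zero,
    add_zero, sigmaSq]
  congr 2 with x
  ring

/-! ### Poisson moments up to order four -/

/-- The Stein–Chen identity for the Poisson distribution. -/
theorem integrable_natCast_mul_poissonMeasure {r : ℝ≥0} {f : ℕ → ℝ}
    (hf : Integrable (fun n => f (n + 1)) (poissonMeasure r)) :
    Integrable (fun n : ℕ => (n : ℝ) * f n) (poissonMeasure r) ∧
      ∫ n : ℕ, (n : ℝ) * f n ∂poissonMeasure r = r * ∫ n, f (n + 1) ∂poissonMeasure r := by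
  have key : ∀ (g : ℕ → ℝ) (n : ℕ), Real.exp (-r) * (r : ℝ) ^ (n + 1) / ((n + 1).factorial : ℝ)
      * (((n + 1 : ℕ) : ℝ) * g (n + 1))
      = r * (Real.exp (-r) * (r : ℝ) ^ n / (n.factorial : ℝ) * g (n + 1)) := by
    intro g n
    have := Nat.factorial_pos n
    rw [Nat.factorial_succ]
    push_cast
    field_simp
    ring
  have hs := integrable_poissonMeasure_iff.1 hf
  have hi : Integrable (fun n : ℕ => (n : ℝ) * f n) (poissonMeasure r) := by
    rw [integrable_poissonMeasure_iff, ← summable_nat_add_iff 1]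
    refine (hs.mul_left (r : ℝ)).congr fun n => ?_
    rw [norm_mul, Real.norm_natCast]
    exact (key (fun n => ‖f n‖) n).symm
  refine ⟨hi, ?_⟩
  have h1 := hasSum_integral_poissonMeasure hi
  have h2 := hasSum_integral_poissonMeasure hf
  -- The factor n kills the term n = 0, so shifting the index loses nothing.
  rw [← hasSum_nat_add_iff' 1] at h1
  simp only [Finset.range_one, Finset.sum_singleton, Nat.cast_zero, zero_mul, mul_zero, sub_zero,
    smul_eq_mul] at h1 h2
  exact h1.unique ((h2.mul_left (r : ℝ)).congr_fun fun n => (key f n))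

/-- Stein–Chen with f(n) = n^k trades n^(k+1) for (n+1)^k. The latter involves all powers up to k,
hence the strong induction. -/
theorem integrable_pow_poissonMeasure (r : ℝ≥0) (k : ℕ) :
    Integrable (fun n : ℕ => (n : ℝ) ^ k) (poissonMeasure r) := by
  induction k using Nat.strong_induction_on with
  | _ k ih =>
    cases k with
    | zero => simp
    | succ k =>
      have h : Integrable (fun n : ℕ => (((n + 1 : ℕ) : ℝ)) ^ k) (poissonMeasure r) := by
        simp only [Nat.cast_add, Nat.cast_one, add_pow, one_pow, mul_one]
        exact integrable_finsetSum _ fun i hi =>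
          (ih i (by simpa using hi)).mul_const _
      simpa [pow_succ'] using (integrable_natCast_mul_poissonMeasure
        (f := fun n => (n : ℝ) ^ k) h).1

/-- Stein–Chen and the binomial theorem give a recursion from which the first four moments are
computed. -/
theorem integral_pow_succ_poissonMeasure (r : ℝ≥0) (k : ℕ) :
    ∫ n : ℕ, (n : ℝ) ^ (k + 1) ∂poissonMeasure r
      = r * ∑ i ∈ Finset.range (k + 1), (∫ n : ℕ, (n : ℝ) ^ i ∂poissonMeasure r) * k.choose i := by
  have e : ∀ n : ℕ, (((n + 1 : ℕ) : ℝ)) ^ k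
      = ∑ i ∈ Finset.range (k + 1), (n : ℝ) ^ i * k.choose i := by
    intro n
    simp [add_pow]
  have h : Integrable (fun n : ℕ => (((n + 1 : ℕ) : ℝ)) ^ k) (poissonMeasure r) := by
    simp only [e]
    exact integrable_finsetSum _ fun i _ => (integrable_pow_poissonMeasure r i).mul_const _
  have := (integrable_natCast_mul_poissonMeasure (f := fun n => (n : ℝ) ^ k) h).2
  simp only [pow_succ', this, e]
  rw [integral_finsetSum _ fun i _ => (integrable_pow_poissonMeasure r i).mul_const _]
  simp only [integral_mul_const]

theorem integral_pow_poissonMeasure (r : ℝ≥0) :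
    ∫ n : ℕ, (n : ℝ) ∂poissonMeasure r = r ∧
    ∫ n : ℕ, (n : ℝ) ^ 2 ∂poissonMeasure r = r ^ 2 + r ∧
    ∫ n : ℕ, (n : ℝ) ^ 3 ∂poissonMeasure r = r ^ 3 + 3 * r ^ 2 + r ∧
    ∫ n : ℕ, (n : ℝ) ^ 4 ∂poissonMeasure r = r ^ 4 + 6 * r ^ 3 + 7 * r ^ 2 + r := by
  have h0 : ∫ n : ℕ, (n : ℝ) ^ 0 ∂poissonMeasure r = 1 := by simp
  have h1 := integral_pow_succ_poissonMeasure r 0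
  have h2 := integral_pow_succ_poissonMeasure r 1
  have h3 := integral_pow_succ_poissonMeasure r 2
  have h4 := integral_pow_succ_poissonMeasure r 3
  simp only [Finset.sum_range_succ, Finset.sum_range_zero, h0, zero_add] at h1 h2 h3 h4
  norm_num [Nat.choose] at h1
  norm_num [Nat.choose, h1] at h2
  norm_num [Nat.choose, h1, h2] at h3
  norm_num [Nat.choose, h1, h2, h3] at h4
  refine ⟨h1, ?_, ?_, ?_⟩
  · rw [h2]; ring
  · rw [h3]; ring
  · rw [h4]; ring

theorem integrable_natCast_poissonMeasure (r : ℝ≥0) :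
    Integrable (fun n : ℕ => (n : ℝ)) (poissonMeasure r) := by
  simpa using integrable_pow_poissonMeasure r 1

theorem integrable_sub_pow_poissonMeasure (r : ℝ≥0) (c : ℝ) (k : ℕ) :
    Integrable (fun n : ℕ => ((n : ℝ) - c) ^ k) (poissonMeasure r) := by
  simp only [sub_eq_add_neg, add_pow]
  exact integrable_finsetSum _ fun i _ =>
    ((integrable_pow_poissonMeasure r i).mul_const _).mul_const _

theorem integral_sub_poissonMeasure (r : ℝ≥0) :
    ∫ n : ℕ, ((n : ℝ) - r) ∂poissonMeasure r = 0 := by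
  rw [integral_sub (integrable_natCast_poissonMeasure r) (integrable_const _)]
  simp [(integral_pow_poissonMeasure r).1]

theorem integral_sub_sq_poissonMeasure (r : ℝ≥0) :
    ∫ n : ℕ, ((n : ℝ) - r) ^ 2 ∂poissonMeasure r = r := by
  have h := integral_pow_poissonMeasure r
  have e : ∀ n : ℕ, ((n : ℝ) - r) ^ 2 = (n : ℝ) ^ 2 - 2 * r * n + (r : ℝ) ^ 2 := fun n => by ring
  simp only [e]
  have i1 := integrable_natCast_poissonMeasure r
  have i2 := integrable_pow_poissonMeasure r 2
  rw [integral_add (integrable_fun_sub i2 (i1.const_mul _)) (integrable_const _),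
    integral_sub i2 (i1.const_mul _), integral_const_mul, h.1, h.2.1]
  simp
  ring

theorem integral_sub_pow_four_poissonMeasure (r : ℝ≥0) :
    ∫ n : ℕ, ((n : ℝ) - r) ^ 4 ∂poissonMeasure r = 3 * r ^ 2 + r := by
  have h := integral_pow_poissonMeasure r
  have e : ∀ n : ℕ, ((n : ℝ) - r) ^ 4 = (n : ℝ) ^ 4 - 4 * r * (n : ℝ) ^ 3
      + 6 * (r : ℝ) ^ 2 * (n : ℝ) ^ 2 - 4 * (r : ℝ) ^ 3 * n + (r : ℝ) ^ 4 := fun n => by ring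
  simp only [e]
  have i1 := (integrable_natCast_poissonMeasure r).const_mul (4 * (r : ℝ) ^ 3)
  have i2 := (integrable_pow_poissonMeasure r 2).const_mul (6 * (r : ℝ) ^ 2)
  have i3 := (integrable_pow_poissonMeasure r 3).const_mul (4 * (r : ℝ))
  have i4 := integrable_pow_poissonMeasure r 4
  rw [integral_add (integrable_fun_sub ((integrable_fun_sub i4 i3).fun_add i2) i1) (integrable_const _),
    integral_sub ((integrable_fun_sub i4 i3).fun_add i2) i1, integral_add (integrable_fun_sub i4 i3) i2, integral_sub i4 i3,
    integral_const_mul, integral_const_mul, integral_const_mul, h.1, h.2.1, h.2.2.1, h.2.2.2]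
  simp
  ring

/-! ### Mean absolute difference of two Poisson variables -/

theorem integral_abs_gaussianReal : ∫ z, |z| ∂gaussianReal 0 1 = Real.sqrt (2 / Real.pi) := by
  rw [integral_gaussianReal_eq_integral_smul (by norm_num)]
  have h1 : ∀ z : ℝ, gaussianPDFReal 0 1 z • |z|
      = (√(2 * Real.pi))⁻¹ * (|z| * Real.exp (-(1 / 2) * |z| ^ 2)) := by
    intro z
    simp only [gaussianPDFReal, smul_eq_mul, NNReal.coe_one, sub_zero, mul_one, sq_abs]
    ring_nf
  simp_rw [h1]
  rw [integral_const_mul, integral_comp_abs (f := fun z => z * Real.exp (-(1 / 2) * z ^ 2))]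
  have h2 := integral_rpow_mul_exp_neg_mul_rpow (p := 2) (q := 1) (b := 1 / 2) (by norm_num)
    (by norm_num) (by norm_num)
  simp only [Real.rpow_one, Real.rpow_two] at h2
  rw [h2]
  norm_num [Real.Gamma_one]
  have h3 : (0 : ℝ) < Real.pi := Real.pi_pos
  have h4 : √(2 : ℝ) * √2 = 2 := Real.mul_self_sqrt (by norm_num)
  field_simp
  nlinarith

theorem abs_sub_min_abs_le (z : ℝ) {K : ℝ} (hK : 0 < K) :
    0 ≤ |z| - min |z| K ∧ |z| - min |z| K ≤ z ^ 2 / K := by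
  refine ⟨sub_nonneg.2 (min_le_left _ _), ?_⟩
  rw [le_div_iff₀ hK, ← sq_abs z]
  rcases le_total |z| K with h | h
  · rw [min_eq_left h]; nlinarith [sq_nonneg |z|]
  · rw [min_eq_right h]; nlinarith [sq_nonneg (|z| - K), sq_nonneg K]

/-- A second moment bound makes truncating |z| at K cost at most 1/K, uniformly over the laws
concerned. This is the uniform integrability that upgrades weak convergence to convergence of E|Z|.
-/
theorem integral_abs_sub_integral_min_abs_le {ν : Measure ℝ} [IsProbabilityMeasure ν]
    (h2 : Integrable (fun z => z ^ 2) ν) (h2' : ∫ z, z ^ 2 ∂ν ≤ 1) {K : ℝ} (hK : 0 < K) :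
    |∫ z, |z| ∂ν - ∫ z, min |z| K ∂ν| ≤ 1 / K := by
  have hm : MemLp (fun z : ℝ => z) 2 ν := (memLp_two_iff_integrable_sq (by fun_prop)).2 h2
  have ha : Integrable (fun z : ℝ => |z|) ν := (hm.integrable (by norm_num)).abs
  have hb : Integrable (fun z : ℝ => min |z| K) ν := ha.inf (integrable_const K)
  rw [← integral_sub ha hb, abs_of_nonneg (integral_nonneg fun z => (abs_sub_min_abs_le z hK).1)]
  calc ∫ z, (|z| - min |z| K) ∂ν ≤ ∫ z, z ^ 2 / K ∂ν :=
        integral_mono (ha.sub hb) (h2.div_const K) fun z => (abs_sub_min_abs_le z hK).2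
    _ = (∫ z, z ^ 2 ∂ν) / K := integral_div _ _
    _ ≤ 1 / K := by gcongr

/-- Weak convergence with bounded second moments implies convergence of first absolute moments. -/
theorem tendsto_integral_abs_of_tendsto {ν : ℕ → ProbabilityMeasure ℝ} {ν₀ : ProbabilityMeasure ℝ}
    (h : Tendsto ν atTop (𝓝 ν₀))
    (h2 : ∀ n, Integrable (fun z => z ^ 2) (ν n : Measure ℝ))
    (h2' : ∀ n, ∫ z, z ^ 2 ∂(ν n : Measure ℝ) ≤ 1)
    (h0 : Integrable (fun z => z ^ 2) (ν₀ : Measure ℝ))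
    (h0' : ∫ z, z ^ 2 ∂(ν₀ : Measure ℝ) ≤ 1) :
    Tendsto (fun n => ∫ z, |z| ∂(ν n : Measure ℝ)) atTop (𝓝 (∫ z, |z| ∂(ν₀ : Measure ℝ))) := by
  rw [Metric.tendsto_atTop]
  intro ε hε
  -- Truncation at 4/ε costs ε/4 for each of the two laws, leaving ε/2 for the weak convergence of
  -- the truncated integrals.
  have hK : (0 : ℝ) < 4 / ε := by positivity
  let f : ℝ →ᵇ ℝ := BoundedContinuousFunction.ofNormedAddCommGroup (fun z => min |z| (4 / ε))
    (by fun_prop) (4 / ε) (fun z => by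
      rw [Real.norm_of_nonneg (le_min (abs_nonneg _) hK.le)]; exact min_le_right _ _)
  have hf := (ProbabilityMeasure.tendsto_iff_forall_integral_tendsto.1 h) f
  obtain ⟨N, hN⟩ := Metric.tendsto_atTop.1 hf (ε / 2) (by positivity)
  refine ⟨N, fun n hn => ?_⟩
  have a := hN n hn
  have b := integral_abs_sub_integral_min_abs_le (h2 n) (h2' n) hK
  have c := integral_abs_sub_integral_min_abs_le h0 h0' hK
  have e : 1 / (4 / ε) = ε / 4 := by field_simp
  rw [e] at b c
  rw [Real.dist_eq] at a ⊢
  change |∫ z, min |z| (4 / ε) ∂(ν n : Measure ℝ) - ∫ z, min |z| (4 / ε) ∂(ν₀ : Measure ℝ)| < _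
    at a
  rw [abs_lt] at *
  rw [abs_le] at *
  constructor <;> linarith [a.1, a.2, b.1, b.2, c.1, c.2]

/-- The mean absolute difference of two independent Poisson variables with rate `r`. -/
def poissonMeanAbsDiff (r : ℝ≥0) : ℝ :=
  ∫ p : ℕ × ℕ, |(p.1 : ℝ) - p.2| ∂(poissonMeasure r).prod (poissonMeasure r)

/-- The law of the normalised difference of two independent Poisson variables. -/
def poissonDiffLaw (r : ℝ≥0) : ProbabilityMeasure ℝ :=
  ⟨((poissonMeasure r).prod (poissonMeasure r)).map
    (fun p : ℕ × ℕ => ((p.1 : ℝ) - p.2) / √(2 * r)),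
    Measure.isProbabilityMeasure_map (Measurable.of_discrete).aemeasurable⟩

/-- The Poisson characteristic functions at u and -u multiply to exp(r(e^{iu} + e^{-iu} - 2)), and
the exponent is 2r(cos u - 1). -/
theorem charFun_poissonDiffLaw (r : ℝ≥0) (t : ℝ) :
    charFun (poissonDiffLaw r : Measure ℝ) t
      = Complex.exp ((2 * r * (Real.cos (t / √(2 * r)) - 1) : ℝ)) := by
  have h : ∀ u : ℝ, ∫ n : ℕ, Complex.exp (u * n * Complex.I) ∂poissonMeasure r
      = Complex.exp (r * (Complex.exp (u * Complex.I) - 1)) := by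
    intro u
    rw [← charFun_map_cast_poissonMeasure, charFun_apply_real,
      integral_map (Measurable.of_discrete).aemeasurable (by fun_prop)]
    simp
  rw [charFun_apply_real, poissonDiffLaw, ProbabilityMeasure.coe_mk,
    integral_map (Measurable.of_discrete).aemeasurable (by fun_prop)]
  set u : ℝ := t / √(2 * r) with hu
  have e : ∀ p : ℕ × ℕ, Complex.exp (t * (((p.1 : ℝ) - p.2) / √(2 * r) : ℝ) * Complex.I)
      = Complex.exp (u * p.1 * Complex.I) * Complex.exp ((-u : ℝ) * p.2 * Complex.I) := by
    intro p
    rw [← Complex.exp_add, hu]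
    congr 1
    push_cast
    ring
  simp_rw [e]
  rw [integral_prod_mul (fun n : ℕ => Complex.exp (u * n * Complex.I))
    (fun n : ℕ => Complex.exp ((-u : ℝ) * n * Complex.I)), h, h, ← Complex.exp_add]
  congr 1
  push_cast
  rw [Complex.cos]
  ring_nf

/-- With u² = t²/(2r), the quadratic term of cos gives exactly -t²/2; the quartic remainder times 2r
is O(1/r). -/
theorem tendsto_two_mul_cos_sub_one (t : ℝ) :
    Tendsto (fun r : ℝ≥0 => 2 * (r : ℝ) * (Real.cos (t / √(2 * r)) - 1)) atTop
      (𝓝 (-(t ^ 2 / 2))) := by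
  have hr : Tendsto (fun r : ℝ≥0 => (r : ℝ)) atTop atTop := NNReal.tendsto_coe_atTop.2 tendsto_id
  have hlim : Tendsto (fun r : ℝ≥0 => t ^ 4 * (5 / 96) / 2 / (r : ℝ)) atTop (𝓝 0) :=
    hr.const_div_atTop _
  rw [tendsto_iff_norm_sub_tendsto_zero]
  refine squeeze_zero' (Eventually.of_forall fun _ => norm_nonneg _) ?_ hlim
  filter_upwards [hr.eventually_ge_atTop (t ^ 2), hr.eventually_gt_atTop 0] with r hrt hr0
  have hs : √(2 * (r : ℝ)) ^ 2 = 2 * r := Real.sq_sqrt (by positivity)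
  have hs0 : 0 < √(2 * (r : ℝ)) := by positivity
  set u := t / √(2 * (r : ℝ)) with hu
  have hu2 : u ^ 2 = t ^ 2 / (2 * r) := by rw [hu, div_pow, hs]
  have hu1 : |u| ≤ 1 := by
    rw [← sq_le_one_iff_abs_le_one, hu2, div_le_one (by positivity)]
    linarith
  have hb := Real.cos_bound hu1
  have hu4 : |u| ^ 4 = t ^ 4 / (4 * r ^ 2) := by
    have : |u| ^ 4 = (u ^ 2) ^ 2 := by rw [← sq_abs u]; ring
    rw [this, hu2]; field_simp; ring
  rw [hu4, hu2] at hb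
  have : 2 * (r : ℝ) * (Real.cos u - 1) - -(t ^ 2 / 2)
      = 2 * r * (Real.cos u - (1 - t ^ 2 / (2 * r) / 2)) := by field_simp; ring
  rw [this, norm_mul, Real.norm_of_nonneg (by positivity), Real.norm_eq_abs]
  calc 2 * (r : ℝ) * |Real.cos u - (1 - t ^ 2 / (2 * r) / 2)|
      ≤ 2 * r * (t ^ 4 / (4 * r ^ 2) * (5 / 96)) := by gcongr
    _ = t ^ 4 * (5 / 96) / 2 / r := by field_simp; ring

theorem integrable_sub_sq_poissonMeasure_prod (r : ℝ≥0) :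
    Integrable (fun p : ℕ × ℕ => ((p.1 : ℝ) - p.2) ^ 2)
      ((poissonMeasure r).prod (poissonMeasure r)) ∧
    ∫ p : ℕ × ℕ, ((p.1 : ℝ) - p.2) ^ 2 ∂(poissonMeasure r).prod (poissonMeasure r) = 2 * r := by
  have i2 := integrable_sub_pow_poissonMeasure r r 2
  have i1 := integrable_sub_pow_poissonMeasure r r 1
  simp only [pow_one] at i1
  have ia := i2.comp_fst (poissonMeasure r)
  have ib := i2.comp_snd (poissonMeasure r)
  have ic := (i1.mul_prod i1).const_mul 2
  have e : ∀ p : ℕ × ℕ, ((p.1 : ℝ) - p.2) ^ 2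
      = ((p.1 : ℝ) - r) ^ 2 + ((p.2 : ℝ) - r) ^ 2 - 2 * (((p.1 : ℝ) - r) * ((p.2 : ℝ) - r)) :=
    fun p => by ring
  simp only [e]
  refine ⟨(ia.add ib).sub ic, ?_⟩
  rw [integral_sub (ia.fun_add ib) ic, integral_add ia ib, integral_const_mul,
    integral_prod_mul (fun n : ℕ => (n : ℝ) - r) (fun n : ℕ => (n : ℝ) - r),
    integral_sub_poissonMeasure, integral_fun_fst (fun n : ℕ => ((n : ℝ) - r) ^ 2),
    integral_fun_snd (fun n : ℕ => ((n : ℝ) - r) ^ 2), integral_sub_sq_poissonMeasure]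
  simp
  ring

/-- The difference has variance 2r and is asymptotically normal after scaling by √(2r), so the limit
is √2 E|N(0,1)| = √2 √(2/π). -/
theorem tendsto_poissonMeanAbsDiff_div_sqrt :
    Tendsto (fun r : ℝ≥0 => poissonMeanAbsDiff r / √r) atTop (𝓝 (2 / √Real.pi)) := by
  refine tendsto_of_seq_tendsto fun r hr => ?_
  have hweak : Tendsto (fun n => poissonDiffLaw (r n)) atTop
      (𝓝 ⟨gaussianReal 0 1, inferInstance⟩) := by
    refine ProbabilityMeasure.tendsto_iff_tendsto_charFun.2 fun t => ?_
    simp only [charFun_poissonDiffLaw, ProbabilityMeasure.coe_mk, charFun_gaussianReal]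
    have := ((Complex.continuous_ofReal.tendsto _).comp
      ((tendsto_two_mul_cos_sub_one t).comp hr)).cexp
    have e : (t : ℂ) * (0 : ℝ) * Complex.I - ((1 : ℝ≥0) : ℝ) * (t : ℂ) ^ 2 / 2
        = ((-(t ^ 2 / 2) : ℝ) : ℂ) := by
      push_cast
      simp
    rw [e]
    exact this
  have hsq : ∀ s : ℝ≥0, Integrable (fun z => z ^ 2) (poissonDiffLaw s : Measure ℝ) ∧
      ∫ z, z ^ 2 ∂(poissonDiffLaw s : Measure ℝ) ≤ 1 := by
    intro s
    have h := integrable_sub_sq_poissonMeasure_prod s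
    rw [poissonDiffLaw, ProbabilityMeasure.coe_mk,
      integrable_map_measure (by fun_prop) (Measurable.of_discrete).aemeasurable,
      integral_map (Measurable.of_discrete).aemeasurable (by fun_prop)]
    have e : ∀ p : ℕ × ℕ, (((p.1 : ℝ) - p.2) / √(2 * s)) ^ 2
        = ((p.1 : ℝ) - p.2) ^ 2 / (2 * s) := fun p => by
      rw [div_pow, Real.sq_sqrt (by positivity)]
    simp only [Function.comp_def, e]
    refine ⟨h.1.div_const _, ?_⟩
    rw [integral_div, h.2]
    -- For s = 0 the quotient is 0/0 = 0, so only the inequality ≤ 1 holds for every rate.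
    exact div_self_le_one _
  have hg : Integrable (fun z : ℝ => z ^ 2) (gaussianReal 0 1) :=
    (memLp_two_iff_integrable_sq (by fun_prop)).1 (memLp_id_gaussianReal 2)
  have hg' : ∫ z, z ^ 2 ∂gaussianReal 0 1 ≤ 1 := by
    have h := variance_id_gaussianReal (μ := 0) (v := 1)
    rw [variance_eq_sub (memLp_id_gaussianReal 2)] at h
    simp only [id_eq, integral_id_gaussianReal, Pi.pow_apply] at h
    norm_num at h
    exact h.le
  have habs := tendsto_integral_abs_of_tendsto hweak (fun n => (hsq _).1) (fun n => (hsq _).2)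
    hg hg'
  rw [ProbabilityMeasure.coe_mk, integral_abs_gaussianReal] at habs
  have e : ∀ s : ℝ≥0, poissonMeanAbsDiff s / √s
      = √2 * ∫ z, |z| ∂(poissonDiffLaw s : Measure ℝ) := by
    intro s
    rw [poissonDiffLaw, ProbabilityMeasure.coe_mk,
      integral_map (Measurable.of_discrete).aemeasurable (by fun_prop)]
    simp only [abs_div, abs_of_nonneg (Real.sqrt_nonneg _)]
    rw [integral_div, Real.sqrt_mul (by norm_num), poissonMeanAbsDiff]
    have : √(2 : ℝ) ≠ 0 := by positivity
    rw [← mul_div_assoc, mul_div_mul_left _ _ this]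
  simp only [e]
  have h2 : 2 / √Real.pi = √2 * √(2 / Real.pi) := by
    rw [← Real.sqrt_mul (by norm_num), ← mul_div_assoc, Real.sqrt_div' _ Real.pi_pos.le]
    congr 1
    rw [Real.sqrt_mul_self (by norm_num)]
  rw [h2]
  exact habs.const_mul _

/-! ### Taylor bounds uniform over a compact set of base points -/

section Taylor

variable {E : Type*} [NormedAddCommGroup E] [NormedSpace ℝ E] {F : E → ℝ} {U S : Set E}

/-- Second-order Taylor expansion, uniform in the base point on a compact set. -/
theorem exists_taylor_two_le (hU : IsOpen U) (hF : ContDiffOn ℝ 2 F U) (hS : IsCompact S)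
    (hSU : S ⊆ U) {ε : ℝ} (hε : 0 < ε) :
    ∃ δ > 0, ∀ x ∈ S, ∀ y, ‖y - x‖ ≤ δ →
      |F y - F x - fderiv ℝ F x (y - x) - (1 / 2) * fderiv ℝ (fderiv ℝ F) x (y - x) (y - x)|
        ≤ ε * ‖y - x‖ ^ 2 := by
  have hF1 : ContDiffOn ℝ 1 (fderiv ℝ F) U := hF.fderiv_of_isOpen hU (by norm_num)
  have hF2 : ContinuousOn (fderiv ℝ (fderiv ℝ F)) U := hF1.continuousOn_fderiv_of_isOpen hU le_rfl
  obtain ⟨δ₁, hδ₁, h1⟩ := hS.exists_thickening_subset_open hU hSU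
  -- This form of uniform continuity compares points of S with nearby points that need not lie in S.
  have huc := hS.uniformContinuousAt_of_continuousAt (fderiv ℝ (fderiv ℝ F))
    (fun a ha => hF2.continuousAt (hU.mem_nhds (hSU ha))) (Metric.dist_mem_uniformity (α := E →L[ℝ] E →L[ℝ] ℝ) hε)
  obtain ⟨δ₂, hδ₂, h2⟩ := Metric.mem_uniformity_dist.1 huc
  refine ⟨min δ₁ δ₂ / 2, by positivity, fun x hx y hy => ?_⟩
  have hmin : 0 < min δ₁ δ₂ := lt_min hδ₁ hδ₂
  have hball : ∀ z ∈ Metric.closedBall x ‖y - x‖, z ∈ U ∧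
      ‖fderiv ℝ (fderiv ℝ F) z - fderiv ℝ (fderiv ℝ F) x‖ ≤ ε := by
    intro z hz
    have hz' : dist x z < min δ₁ δ₂ := by
      rw [dist_comm]; exact lt_of_le_of_lt (Metric.mem_closedBall.1 hz) (by linarith)
    refine ⟨h1 (Metric.mem_thickening_iff.2 ⟨x, hx, ?_⟩), ?_⟩
    · rw [dist_comm]; exact hz'.trans_le (min_le_left _ _)
    · have := h2 (hz'.trans_le (min_le_right _ _)) hx
      refine le_trans (le_of_eq ?_) (le_of_lt (show dist _ _ < ε from this))
      rw [dist_comm]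
      exact (dist_eq_norm (E := E →L[ℝ] E →L[ℝ] ℝ) _ _).symm
  have hconv : Convex ℝ (Metric.closedBall x ‖y - x‖) := convex_closedBall _ _
  have hxb : x ∈ Metric.closedBall x ‖y - x‖ := Metric.mem_closedBall_self (norm_nonneg _)
  have hyb : y ∈ Metric.closedBall x ‖y - x‖ := by simp [dist_eq_norm]
  have hd1 : ∀ z ∈ Metric.closedBall x ‖y - x‖,
      HasFDerivAt (fderiv ℝ F) (fderiv ℝ (fderiv ℝ F) z) z := fun z hz =>
    ((hF1.contDiffAt (hU.mem_nhds (hball z hz).1)).differentiableAt (by norm_num)).hasFDerivAt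
  have hd0 : ∀ z ∈ Metric.closedBall x ‖y - x‖, HasFDerivAt F (fderiv ℝ F z) z := fun z hz =>
    ((hF.contDiffAt (hU.mem_nhds (hball z hz).1)).differentiableAt (by norm_num)).hasFDerivAt
  have hsymm : IsSymmSndFDerivAt ℝ F x :=
    (hF.contDiffAt (hU.mem_nhds (hSU hx))).isSymmSndFDerivAt (by simp)
  have hfirst : ∀ z ∈ Metric.closedBall x ‖y - x‖,
      ‖fderiv ℝ F z - fderiv ℝ F x - fderiv ℝ (fderiv ℝ F) x (z - x)‖ ≤ ε * ‖y - x‖ := by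
    intro z hz
    refine (hconv.norm_image_sub_le_of_norm_hasFDerivWithin_le'
      (fun w hw => (hd1 w hw).hasFDerivWithinAt) (fun w hw => (hball w hw).2) hxb hz).trans ?_
    gcongr
    simpa [dist_eq_norm] using hz
  -- The mean value inequality is used twice: `hfirst` bounds the error of the linearised gradient,
  -- which is the derivative of `Q`, and a second application to `Q` bounds the Taylor remainder.
  let Q : E → ℝ := fun z => F z - fderiv ℝ F x (z - x)
    - (1 / 2) * fderiv ℝ (fderiv ℝ F) x (z - x) (z - x)
  have hQ : ∀ z ∈ Metric.closedBall x ‖y - x‖, HasFDerivWithinAt Q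
      (fderiv ℝ F z - fderiv ℝ F x - fderiv ℝ (fderiv ℝ F) x (z - x))
      (Metric.closedBall x ‖y - x‖) z := by
    intro z hz
    have hid : HasFDerivAt (fun z : E => z - x) (ContinuousLinearMap.id ℝ E) z :=
      (hasFDerivAt_id z).sub_const x
    have hA := (fderiv ℝ F x).hasFDerivAt.comp z hid
    have hB := (fderiv ℝ (fderiv ℝ F) x).hasFDerivAt.comp z hid
    have hC := (hB.clm_apply hid).const_mul (1 / 2 : ℝ)
    have hall := (((hd0 z hz).sub hA).sub hC).hasFDerivWithinAt
      (s := Metric.closedBall x ‖y - x‖)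
    refine hall.congr_fderiv ?_
    ext w
    simp only [Function.comp_apply, sub_apply, smul_apply,
      add_apply, ContinuousLinearMap.comp_apply, ContinuousLinearMap.id_apply,
      ContinuousLinearMap.flip_apply, smul_eq_mul]
    -- Symmetry of the second derivative merges the two terms of the product rule and cancels the
    -- factor 1/2.
    rw [hsymm w (z - x)]
    ring
  have hlast := hconv.norm_image_sub_le_of_norm_hasFDerivWithin_le hQ hfirst hxb hyb
  rw [Real.norm_eq_abs] at hlast
  refine le_of_eq_of_le ?_ (hlast.trans_eq (by ring))
  congr 1
  simp [Q]
  ring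

/-- A second-order Taylor bound for bounded functions, uniform in the base point on a compact set
and global in the other point. -/
theorem exists_taylor_two_le_add (hU : IsOpen U) (hF : ContDiffOn ℝ 2 F U) (hS : IsCompact S)
    (hSU : S ⊆ U) (hF01 : ∀ x y, |F y - F x| ≤ 1) {ε : ℝ} (hε : 0 < ε) :
    ∃ C, 0 ≤ C ∧ ∀ x ∈ S, ∀ y,
      |F y - F x - fderiv ℝ F x (y - x) - (1 / 2) * fderiv ℝ (fderiv ℝ F) x (y - x) (y - x)|
        ≤ ε * ‖y - x‖ ^ 2 + C * ‖y - x‖ ^ 4 := by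
  have hF1 : ContDiffOn ℝ 1 (fderiv ℝ F) U := hF.fderiv_of_isOpen hU (by norm_num)
  have hF2 : ContinuousOn (fderiv ℝ (fderiv ℝ F)) U := hF1.continuousOn_fderiv_of_isOpen hU le_rfl
  obtain ⟨M₁, hM₁⟩ := hS.exists_bound_of_continuousOn (hF1.continuousOn.mono hSU)
  obtain ⟨M₂, hM₂⟩ := hS.exists_bound_of_continuousOn
    (E := E →L[ℝ] E →L[ℝ] ℝ) (hF2.mono hSU)
  obtain ⟨δ, hδ, h⟩ := exists_taylor_two_le hU hF hS hSU hε
  -- The local bound covers ‖v‖ ≤ δ. Beyond, q = ‖v‖/δ ≥ 1, and the crude bound 1 + |M₁|δq +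
  -- |M₂|δ²q²/2 is at most its coefficient sum times q⁴.
  refine ⟨(1 + |M₁| * δ + (1 / 2) * |M₂| * δ ^ 2) / δ ^ 4, by positivity, fun x hx y => ?_⟩
  set v := y - x with hv
  rcases le_total ‖v‖ δ with hd | hd
  · refine (h x hx y hd).trans (le_add_of_nonneg_right (by positivity))
  · have hq : 1 ≤ ‖v‖ / δ := (one_le_div hδ).2 hd
    set q := ‖v‖ / δ with hqd
    have hvq : ‖v‖ = δ * q := by rw [hqd]; field_simp
    have b1 : |fderiv ℝ F x v| ≤ |M₁| * ‖v‖ := by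
      refine ((fderiv ℝ F x).le_opNorm v).trans ?_
      gcongr
      exact (hM₁ x hx).trans (le_abs_self _)
    have b2 : |fderiv ℝ (fderiv ℝ F) x v v| ≤ |M₂| * ‖v‖ * ‖v‖ := by
      refine ((fderiv ℝ (fderiv ℝ F) x).le_opNorm₂ v v).trans ?_
      gcongr
      exact (hM₂ x hx).trans (le_abs_self _)
    have t : |F y - F x - fderiv ℝ F x v - (1 / 2) * fderiv ℝ (fderiv ℝ F) x v v|
        ≤ 1 + |M₁| * ‖v‖ + (1 / 2) * (|M₂| * ‖v‖ * ‖v‖) := by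
      have := hF01 x y
      rw [abs_le] at *
      constructor <;> linarith [b1.1, b1.2, b2.1, b2.2, this.1, this.2]
    have q1 : q ≤ q ^ 4 := le_self_pow₀ hq (by norm_num)
    have q2 : q ^ 2 ≤ q ^ 4 := pow_le_pow_right₀ hq (by norm_num)
    have q0 : 1 ≤ q ^ 4 := one_le_pow₀ hq
    have e : (1 + |M₁| * δ + (1 / 2) * |M₂| * δ ^ 2) / δ ^ 4 * ‖v‖ ^ 4
        = 1 * q ^ 4 + |M₁| * δ * q ^ 4 + (1 / 2) * |M₂| * δ ^ 2 * q ^ 4 := by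
      rw [hvq]; field_simp
    have e2 : 1 + |M₁| * ‖v‖ + (1 / 2) * (|M₂| * ‖v‖ * ‖v‖)
        = 1 * 1 + |M₁| * δ * q + (1 / 2) * |M₂| * δ ^ 2 * q ^ 2 := by
      rw [hvq]; ring
    rw [e2] at t
    rw [e]
    have : 1 * 1 + |M₁| * δ * q + (1 / 2) * |M₂| * δ ^ 2 * q ^ 2
        ≤ 1 * q ^ 4 + |M₁| * δ * q ^ 4 + (1 / 2) * |M₂| * δ ^ 2 * q ^ 4 := by gcongr
    have : 0 ≤ ε * ‖v‖ ^ 2 := by positivity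
    linarith

/-- A first-order Taylor bound for bounded functions, uniform in the base point on a compact set
and global in the other point. -/
theorem exists_taylor_one_le (hU : IsOpen U) (hF : ContDiffOn ℝ 2 F U) (hS : IsCompact S)
    (hSU : S ⊆ U) (hF01 : ∀ x y, |F y - F x| ≤ 1) :
    ∃ C, 0 ≤ C ∧ ∀ x ∈ S, ∀ y, |F y - F x - fderiv ℝ F x (y - x)| ≤ C * ‖y - x‖ ^ 2 := by
  have hF1 : ContDiffOn ℝ 1 (fderiv ℝ F) U := hF.fderiv_of_isOpen hU (by norm_num)
  have hF2 : ContinuousOn (fderiv ℝ (fderiv ℝ F)) U := hF1.continuousOn_fderiv_of_isOpen hU le_rfl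
  obtain ⟨M₁, hM₁⟩ := hS.exists_bound_of_continuousOn (hF1.continuousOn.mono hSU)
  obtain ⟨M₂, hM₂⟩ := hS.exists_bound_of_continuousOn
    (E := E →L[ℝ] E →L[ℝ] ℝ) (hF2.mono hSU)
  obtain ⟨δ, hδ, h⟩ := exists_taylor_two_le hU hF hS hSU one_pos
  -- The first summand handles ‖v‖ ≥ δ, where 1 and q are at most q²; the second handles ‖v‖ ≤ δ, as
  -- the local remainder plus the quadratic Taylor term.
  refine ⟨(1 + |M₁| * δ) / δ ^ 2 + (1 + |M₂| / 2), by positivity, fun x hx y => ?_⟩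
  set v := y - x with hv
  rcases le_total ‖v‖ δ with hd | hd
  · have t := h x hx y hd
    have b2 : |fderiv ℝ (fderiv ℝ F) x v v| ≤ |M₂| * ‖v‖ * ‖v‖ := by
      refine ((fderiv ℝ (fderiv ℝ F) x).le_opNorm₂ v v).trans ?_
      gcongr
      exact (hM₂ x hx).trans (le_abs_self _)
    have : 0 ≤ (1 + |M₁| * δ) / δ ^ 2 * ‖v‖ ^ 2 := by positivity
    rw [abs_le] at *
    constructor <;> nlinarith [b2.1, b2.2, t.1, t.2]
  · have hq : 1 ≤ ‖v‖ / δ := (one_le_div hδ).2 hd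
    set q := ‖v‖ / δ with hqd
    have hvq : ‖v‖ = δ * q := by rw [hqd]; field_simp
    have b1 : |fderiv ℝ F x v| ≤ |M₁| * ‖v‖ := by
      refine ((fderiv ℝ F x).le_opNorm v).trans ?_
      gcongr
      exact (hM₁ x hx).trans (le_abs_self _)
    have t : |F y - F x - fderiv ℝ F x v| ≤ 1 * 1 + |M₁| * δ * q := by
      have := hF01 x y
      rw [hvq] at b1
      rw [abs_le] at *
      constructor <;> linarith [b1.1, b1.2, this.1, this.2]
    have q1 : q ≤ q ^ 2 := le_self_pow₀ hq (by norm_num)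
    have q0 : 1 ≤ q ^ 2 := one_le_pow₀ hq
    have e : (1 + |M₁| * δ) / δ ^ 2 * ‖v‖ ^ 2 = 1 * q ^ 2 + |M₁| * δ * q ^ 2 := by
      rw [hvq]; field_simp
    have : 1 * 1 + |M₁| * δ * q ≤ 1 * q ^ 2 + |M₁| * δ * q ^ 2 := by gcongr
    have : 0 ≤ (1 + |M₂| / 2) * ‖v‖ ^ 2 := by positivity
    rw [add_mul, e]
    linarith

end Taylor

/-! ### Passage to coordinates and partial derivatives -/

theorem isOpen_openOrthant (d : ℕ) : IsOpen (openOrthant d) := by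
  have : openOrthant d = ⋂ j, {x : Fin d → ℝ | 0 < x j} := by
    ext x; simp [openOrthant]
  rw [this]
  exact isOpen_iInter_of_finite fun j => isOpen_lt continuous_const (continuous_apply j)

/-- Turns remainders in the sup norm into sums over coordinates, whose Poisson expectations are
explicit. -/
theorem norm_pow_le_sum {d : ℕ} (v : Fin d → ℝ) {k : ℕ} (hk : k ≠ 0) :
    ‖v‖ ^ k ≤ ∑ j, |v j| ^ k := by
  rcases isEmpty_or_nonempty (Fin d) with h | h
  · have : v = 0 := Subsingleton.elim _ _
    simp [this, hk]
  · obtain ⟨j, -, hj⟩ := Finset.exists_max_image Finset.univ (fun j => |v j|)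
      Finset.univ_nonempty
    have : ‖v‖ ≤ |v j| := (pi_norm_le_iff_of_nonempty v).2 fun i => hj i (Finset.mem_univ i)
    calc ‖v‖ ^ k ≤ |v j| ^ k := by gcongr
      _ ≤ ∑ j, |v j| ^ k := Finset.single_le_sum (f := fun j => |v j| ^ k)
          (fun i _ => by positivity) (Finset.mem_univ j)

theorem continuousLinearMap_apply_eq_sum {d : ℕ} {G : Type*} [NormedAddCommGroup G]
    [NormedSpace ℝ G] (L : (Fin d → ℝ) →L[ℝ] G) (v : Fin d → ℝ) :
    L v = ∑ j, v j • L (Pi.single j 1) := by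
  conv_lhs => rw [pi_eq_sum_univ' v]
  simp

section Partial

variable {d : ℕ} {F : (Fin d → ℝ) → ℝ} {U S : Set (Fin d → ℝ)}

theorem partialDeriv_eq_fderiv (hU : IsOpen U) (hF : ContDiffOn ℝ 2 F U) {x : Fin d → ℝ}
    (hx : x ∈ U) (j : Fin d) : partialDeriv j F x = fderiv ℝ F x (Pi.single j 1) :=
  ((hF.contDiffAt (hU.mem_nhds hx)).differentiableAt (by norm_num)).lineDeriv_eq_fderiv

theorem hasFDerivAt_partialDeriv (hU : IsOpen U) (hF : ContDiffOn ℝ 2 F U) {x : Fin d → ℝ}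
    (hx : x ∈ U) (j : Fin d) :
    HasFDerivAt (partialDeriv j F)
      ((fderiv ℝ (fderiv ℝ F) x).flip (Pi.single j 1)) x := by
  have hF1 : ContDiffOn ℝ 1 (fderiv ℝ F) U := hF.fderiv_of_isOpen hU (by norm_num)
  have hd : HasFDerivAt (fderiv ℝ F) (fderiv ℝ (fderiv ℝ F) x) x :=
    ((hF1.contDiffAt (hU.mem_nhds hx)).differentiableAt (by norm_num)).hasFDerivAt
  have he : partialDeriv j F =ᶠ[𝓝 x] fun z => fderiv ℝ F z (Pi.single j 1) := by
    filter_upwards [hU.mem_nhds hx] with z hz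
    exact partialDeriv_eq_fderiv hU hF hz j
  refine HasFDerivAt.congr_of_eventuallyEq ?_ he
  have := hd.clm_apply (hasFDerivAt_const (Pi.single j (1 : ℝ) : Fin d → ℝ) x)
  refine this.congr_fderiv ?_
  ext w
  simp

theorem partialDeriv_partialDeriv_eq (hU : IsOpen U) (hF : ContDiffOn ℝ 2 F U) {x : Fin d → ℝ}
    (hx : x ∈ U) (i j : Fin d) : partialDeriv i (partialDeriv j F) x
      = fderiv ℝ (fderiv ℝ F) x (Pi.single i 1) (Pi.single j 1) := by
  have h := hasFDerivAt_partialDeriv hU hF hx j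
  have := h.differentiableAt.lineDeriv_eq_fderiv (v := (Pi.single i 1 : Fin d → ℝ))
  rw [h.fderiv] at this
  exact this

theorem continuousOn_partialDeriv (hU : IsOpen U) (hF : ContDiffOn ℝ 2 F U) (j : Fin d) :
    ContinuousOn (partialDeriv j F) U := fun _ hx =>
  (hasFDerivAt_partialDeriv hU hF hx j).continuousAt.continuousWithinAt

theorem continuousOn_partialDeriv_partialDeriv (hU : IsOpen U) (hF : ContDiffOn ℝ 2 F U)
    (i j : Fin d) : ContinuousOn (partialDeriv i (partialDeriv j F)) U := by
  have hF1 : ContDiffOn ℝ 1 (fderiv ℝ F) U := hF.fderiv_of_isOpen hU (by norm_num)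
  have hF2 : ContinuousOn (fderiv ℝ (fderiv ℝ F)) U := hF1.continuousOn_fderiv_of_isOpen hU le_rfl
  exact ((hF2.clm_apply continuousOn_const).clm_apply continuousOn_const).congr
    fun x hx => partialDeriv_partialDeriv_eq hU hF hx i j

theorem continuousOn_V (hU : IsOpen U) (hF : ContDiffOn ℝ 2 F U) : ContinuousOn (V F) U :=
  continuousOn_finsetSum _ fun j _ => (continuousOn_partialDeriv hU hF j).mul
    (by fun_prop)

theorem continuousOn_B (hU : IsOpen U) (hF : ContDiffOn ℝ 2 F U) : ContinuousOn (B F) U :=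
  continuousOn_const.mul (continuousOn_finsetSum _ fun j _ =>
    (by fun_prop : ContinuousOn (fun x : Fin d → ℝ => x j) U).mul
      (continuousOn_partialDeriv_partialDeriv hU hF j j))

theorem continuousOn_sigmaSq (hF : ContDiffOn ℝ 2 F U) : ContinuousOn (sigmaSq F) U :=
  hF.continuousOn.mul (continuousOn_const.sub hF.continuousOn)

theorem exists_partial_taylor_two_le (hU : IsOpen U) (hF : ContDiffOn ℝ 2 F U) (hS : IsCompact S)
    (hSU : S ⊆ U) (hF01 : ∀ x y, |F y - F x| ≤ 1) {ε : ℝ} (hε : 0 < ε) :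
    ∃ C, 0 ≤ C ∧ ∀ x ∈ S, ∀ y,
      |F y - F x - ∑ j, partialDeriv j F x * (y j - x j)
        - (1 / 2) * ∑ i, ∑ j, partialDeriv i (partialDeriv j F) x * ((y i - x i) * (y j - x j))|
        ≤ ∑ j, (ε * (y j - x j) ^ 2 + C * (y j - x j) ^ 4) := by
  obtain ⟨C, hC, h⟩ := exists_taylor_two_le_add hU hF hS hSU hF01 hε
  refine ⟨C, hC, fun x hx y => ?_⟩
  have e1 : fderiv ℝ F x (y - x) = ∑ j, partialDeriv j F x * (y j - x j) := by
    rw [continuousLinearMap_apply_eq_sum]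
    refine Finset.sum_congr rfl fun j _ => ?_
    rw [partialDeriv_eq_fderiv hU hF (hSU hx), smul_eq_mul, mul_comm, Pi.sub_apply]
  have e2 : fderiv ℝ (fderiv ℝ F) x (y - x) (y - x)
      = ∑ i, ∑ j, partialDeriv i (partialDeriv j F) x * ((y i - x i) * (y j - x j)) := by
    rw [continuousLinearMap_apply_eq_sum (fderiv ℝ (fderiv ℝ F) x), sum_apply]
    refine Finset.sum_congr rfl fun i _ => ?_
    rw [smul_apply, continuousLinearMap_apply_eq_sum, smul_eq_mul,
      Finset.mul_sum]
    refine Finset.sum_congr rfl fun j _ => ?_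
    rw [partialDeriv_partialDeriv_eq hU hF (hSU hx), smul_eq_mul, Pi.sub_apply, Pi.sub_apply]
    ring
  rw [← e1, ← e2]
  refine (h x hx y).trans ?_
  rw [Finset.sum_add_distrib, ← Finset.mul_sum, ← Finset.mul_sum]
  have n2 := norm_pow_le_sum (y - x) (two_ne_zero)
  have n4 := norm_pow_le_sum (y - x) (four_ne_zero)
  simp only [Pi.sub_apply, sq_abs, Even.pow_abs (show Even 4 by decide)] at n2 n4
  gcongr

theorem exists_partial_taylor_one_le (hU : IsOpen U) (hF : ContDiffOn ℝ 2 F U) (hS : IsCompact S)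
    (hSU : S ⊆ U) (hF01 : ∀ x y, |F y - F x| ≤ 1) :
    ∃ C, 0 ≤ C ∧ ∀ x ∈ S, ∀ y, |F y - F x - ∑ j, partialDeriv j F x * (y j - x j)|
        ≤ C * ∑ j, (y j - x j) ^ 2 := by
  obtain ⟨C, hC, h⟩ := exists_taylor_one_le hU hF hS hSU hF01
  refine ⟨C, hC, fun x hx y => ?_⟩
  have e1 : fderiv ℝ F x (y - x) = ∑ j, partialDeriv j F x * (y j - x j) := by
    rw [continuousLinearMap_apply_eq_sum]
    refine Finset.sum_congr rfl fun j _ => ?_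
    rw [partialDeriv_eq_fderiv hU hF (hSU hx), smul_eq_mul, mul_comm, Pi.sub_apply]
  rw [← e1]
  refine (h x hx y).trans ?_
  have n2 := norm_pow_le_sum (y - x) (two_ne_zero)
  simp only [Pi.sub_apply, sq_abs] at n2
  gcongr

end Partial

/-- `V` is nonnegative, and `B` vanishes wherever `V` does. -/
theorem V_nonneg_and_B_eq_zero {d : ℕ} {F : (Fin d → ℝ) → ℝ} (hmono : Monotone F)
    (hF : ContDiffOn ℝ 2 F (openOrthant d)) {x : Fin d → ℝ} (hx : x ∈ openOrthant d) :
    0 ≤ V F x ∧ (V F x = 0 → B F x = 0) := by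
  have hU := isOpen_openOrthant d
  have hpos : ∀ j, ∀ z ∈ openOrthant d, 0 ≤ partialDeriv j F z := by
    intro j z _
    have hm : Monotone fun t : ℝ => F (z + t • Pi.single j 1) := by
      intro s t hst
      refine hmono (add_le_add_right (smul_le_smul_of_nonneg_right hst ?_) z)
      exact Pi.single_nonneg.2 zero_le_one
    exact hm.deriv_nonneg
  have hterm : ∀ j, 0 ≤ partialDeriv j F x * √(x j / Real.pi) := fun j =>
    mul_nonneg (hpos j x hx) (Real.sqrt_nonneg _)
  refine ⟨Finset.sum_nonneg fun j _ => hterm j, fun hV => ?_⟩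
  unfold V at hV
  rw [Finset.sum_eq_zero_iff_of_nonneg fun j _ => hterm j] at hV
  unfold B
  rw [Finset.sum_eq_zero, mul_zero]
  intro j _
  have hxj : 0 < √(x j / Real.pi) := Real.sqrt_pos.2 (div_pos (hx j) Real.pi_pos)
  have h0 : partialDeriv j F x = 0 :=
    (mul_eq_zero.1 (hV j (Finset.mem_univ j))).resolve_right hxj.ne'
  -- Monotonicity of F makes ∂_jF nonnegative on the open orthant, so a zero of it is an interior
  -- minimum and its own derivative vanishes there.
  have hmin : IsLocalMin (partialDeriv j F) x := by
    filter_upwards [hU.mem_nhds hx] with z hz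
    rw [h0]
    exact hpos j z hz
  have hd := hasFDerivAt_partialDeriv hU hF hx j
  have hz := hmin.hasFDerivAt_eq_zero hd
  rw [hz] at hd
  have := hd.differentiableAt.lineDeriv_eq_fderiv (v := (Pi.single j 1 : Fin d → ℝ))
  rw [hd.fderiv] at this
  have h2 : partialDeriv j (partialDeriv j F) x = 0 := this
  rw [h2, mul_zero]

/-! ### The Szász–Mirakyan operator as a Poisson expectation -/

section Operator

variable {d : ℕ}

/-- The product Poisson law on `ℕ₀^d` with rates `m x_j`. -/
def poissonPi (m : ℝ) (x : Fin d → ℝ) : Measure (Fin d → ℕ) :=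
  Measure.pi fun j => poissonMeasure (m * x j).toNNReal

instance (m : ℝ) (x : Fin d → ℝ) : IsProbabilityMeasure (poissonPi m x) := by
  unfold poissonPi; infer_instance

/-- The smoothed indicator `∑_k 1{y ≤ k/m} P_{k,m}(x)`. -/
def smoothIndicator (m : ℝ) (x y : Fin d → ℝ) : ℝ :=
  ∫ k, (Set.Iic (fun j => (k j : ℝ) / m)).indicator (fun _ => (1 : ℝ)) y ∂poissonPi m x

theorem poissonPi_real_singleton (m : ℝ) (x : Fin d → ℝ) (k : Fin d → ℕ) :
    (poissonPi m x).real {k} = ∏ j, (Real.exp (-((m * x j).toNNReal : ℝ))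
      * ((m * x j).toNNReal : ℝ) ^ k j / ((k j).factorial : ℝ)) := by
  rw [measureReal_def, poissonPi, Measure.pi_singleton, ENNReal.toReal_prod]
  exact Finset.prod_congr rfl fun j _ => poissonMeasure_real_singleton _ _

theorem indicator_nonneg_le_one (s : Set (Fin d → ℝ)) (y : Fin d → ℝ) :
    0 ≤ s.indicator (fun _ => (1 : ℝ)) y ∧ s.indicator (fun _ => (1 : ℝ)) y ≤ 1 :=
  ⟨Set.indicator_nonneg (fun _ _ => zero_le_one) _,
    Set.indicator_le_self' (fun _ _ => zero_le_one) _⟩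

theorem norm_indicator_le_one (s : Set (Fin d → ℝ)) (y : Fin d → ℝ) :
    ‖s.indicator (fun _ => (1 : ℝ)) y‖ ≤ 1 := by
  rw [Real.norm_of_nonneg (indicator_nonneg_le_one s y).1]
  exact (indicator_nonneg_le_one s y).2

theorem integrable_indicator_Iic {K : Type*} [MeasurableSpace K] [DiscreteMeasurableSpace K]
    {ν : Measure K} [IsFiniteMeasure ν] (h : K → Fin d → ℝ) (y : Fin d → ℝ) :
    Integrable (fun k => (Set.Iic (h k)).indicator (fun _ => (1 : ℝ)) y) ν :=
  Integrable.of_bound (Measurable.of_discrete).aestronglyMeasurable 1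
    (ae_of_all _ fun _ => norm_indicator_le_one _ _)

/-- The integrating law itself varies with x; joint measurability is read off from the countable
series of explicit weights. -/
theorem measurable_smoothIndicator (m : ℝ) :
    Measurable (Function.uncurry (smoothIndicator (d := d) m)) := by
  have e : Function.uncurry (smoothIndicator (d := d) m) = fun p => ∑' k : Fin d → ℕ,
      (∏ j, (Real.exp (-((m * p.1 j).toNNReal : ℝ))
      * ((m * p.1 j).toNNReal : ℝ) ^ k j / ((k j).factorial : ℝ)))
      • (Set.Iic (fun j => (k j : ℝ) / m)).indicator (fun _ => (1 : ℝ)) p.2 := by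
    ext ⟨x, y⟩
    simp only [Function.uncurry, smoothIndicator]
    rw [integral_countable (integrable_indicator_Iic (fun (k : Fin d → ℕ) j => (k j : ℝ) / m) y)]
    simp only [poissonPi_real_singleton]
  rw [e]
  refine Measurable.tsum fun k => ?_
  have h1 : Measurable fun p : (Fin d → ℝ) × (Fin d → ℝ) =>
      ∏ j, (Real.exp (-((m * p.1 j).toNNReal : ℝ))
      * ((m * p.1 j).toNNReal : ℝ) ^ k j / ((k j).factorial : ℝ)) :=
    Finset.measurable_fun_prod _ fun j _ => by fun_prop
  have h2 : Measurable fun p : (Fin d → ℝ) × (Fin d → ℝ) =>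
      (Set.Iic (fun j => (k j : ℝ) / m)).indicator (fun _ => (1 : ℝ)) p.2 :=
    (measurable_const.indicator measurableSet_Iic).comp measurable_snd
  exact h1.smul h2

theorem smoothIndicator_nonneg (m : ℝ) (x y : Fin d → ℝ) : 0 ≤ smoothIndicator m x y :=
  integral_nonneg fun _ => (indicator_nonneg_le_one _ _).1

theorem smoothIndicator_le_one (m : ℝ) (x y : Fin d → ℝ) : smoothIndicator m x y ≤ 1 := by
  refine (integral_mono (integrable_indicator_Iic (ν := poissonPi m x)
    (fun (k : Fin d → ℕ) j => (k j : ℝ) / m) y) (integrable_const (1 : ℝ))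
    fun k => (indicator_nonneg_le_one _ y).2).trans_eq ?_
  simp

/-- Positivity of x is needed because `poissonPi` truncates its rates by `Real.toNNReal`, while the
weights of the estimator do not. -/
theorem estimator_eq {Ω : Type*} (X : ℕ → Ω → Fin d → ℝ) {m : ℝ} (hm : 0 < m) (n : ℕ) (ω : Ω)
    {x : Fin d → ℝ} (hx : x ∈ openOrthant d) :
    estimator X (fun _ => m) n ω x
      = (1 / (n : ℝ)) * ∑ i ∈ Finset.range n, smoothIndicator m x (X i ω) := by
  have hi : ∀ i, Integrable (fun k : Fin d → ℕ =>
      (Set.Iic (fun j => (k j : ℝ) / m)).indicator (fun _ => (1 : ℝ)) (X i ω)) (poissonPi m x) :=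
    fun i => integrable_indicator_Iic (fun (k : Fin d → ℕ) j => (k j : ℝ) / m) _
  have h : ∫ k : Fin d → ℕ, empiricalCDF X n ω (fun j => (k j : ℝ) / m) ∂poissonPi m x
      = (1 / (n : ℝ)) * ∑ i ∈ Finset.range n, smoothIndicator m x (X i ω) := by
    simp only [empiricalCDF]
    rw [integral_const_mul, integral_finsetSum _ fun i _ => hi i]
    rfl
  have he : Integrable (fun k : Fin d → ℕ => empiricalCDF X n ω (fun j => (k j : ℝ) / m))
      (poissonPi m x) := (integrable_finsetSum _ fun i _ => hi i).const_mul _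
  rw [← h, integral_countable he]
  refine tsum_congr fun k => ?_
  rw [poissonPi_real_singleton, smul_eq_mul, mul_comm]
  congr 1
  refine Finset.prod_congr rfl fun j _ => ?_
  rw [Real.coe_toNNReal _ (mul_nonneg hm.le (hx j).le)]

theorem integral_integral_indicator_Iic (μ : Measure (Fin d → ℝ)) [IsProbabilityMeasure μ]
    {K : Type*} [MeasurableSpace K] [DiscreteMeasurableSpace K] {ν : Measure K}
    [IsProbabilityMeasure ν] (h : K → Fin d → ℝ) :
    ∫ y, ∫ k, (Set.Iic (h k)).indicator (fun _ => (1 : ℝ)) y ∂ν ∂μ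
      = ∫ k, jointCDF μ (h k) ∂ν := by
  have hh : Measurable h := Measurable.of_discrete
  have hm : Measurable (Function.uncurry fun (y : Fin d → ℝ) (k : K) =>
      (Set.Iic (h k)).indicator (fun _ => (1 : ℝ)) y) :=
    measurable_indicator_Iic.comp ((hh.comp measurable_snd).prodMk measurable_fst)
  rw [integral_integral_swap (Integrable.of_bound hm.aestronglyMeasurable 1
    (ae_of_all _ fun p => norm_indicator_le_one _ _))]
  simp only [jointCDF_eq_integral]

theorem integral_smoothIndicator (μ : Measure (Fin d → ℝ)) [IsProbabilityMeasure μ] (m : ℝ)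
    (x : Fin d → ℝ) : ∫ y, smoothIndicator m x y ∂μ
      = ∫ k, jointCDF μ (fun j => (k j : ℝ) / m) ∂poissonPi m x :=
  integral_integral_indicator_Iic μ fun (k : Fin d → ℕ) j => (k j : ℝ) / m

/-- The square is an expectation over two independent copies, and the two events y ≤ K/m and y ≤
K'/m together say that y lies below the coordinatewise minimum. -/
theorem integral_smoothIndicator_sq (μ : Measure (Fin d → ℝ)) [IsProbabilityMeasure μ] (m : ℝ)
    (x : Fin d → ℝ) : ∫ y, smoothIndicator m x y ^ 2 ∂μ
      = ∫ p : (Fin d → ℕ) × (Fin d → ℕ),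
          jointCDF μ (fun j => min ((p.1 j : ℝ) / m) ((p.2 j : ℝ) / m))
          ∂(poissonPi m x).prod (poissonPi m x) := by
  rw [← integral_integral_indicator_Iic]
  congr 1 with y
  rw [sq, smoothIndicator, ← integral_prod_mul]
  congr 1 with p
  have : Set.Iic (fun j => min ((p.1 j : ℝ) / m) ((p.2 j : ℝ) / m))
      = Set.Iic (fun j => (p.1 j : ℝ) / m) ∩ Set.Iic (fun j => (p.2 j : ℝ) / m) :=
    Set.Iic_inter_Iic.symm
  rw [this]
  have := Set.inter_indicator_mul (s := Set.Iic fun j => (p.1 j : ℝ) / m)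
    (t := Set.Iic fun j => (p.2 j : ℝ) / m) (fun _ => (1 : ℝ)) (fun _ => (1 : ℝ)) y
  simp only [mul_one] at this
  exact this.symm

/-! ### Moments of the rescaled product Poisson law -/

section Moments

variable {m : ℝ} {x : Fin d → ℝ}

theorem integral_comp_eval_poissonPi (hm : 0 < m) (hx : x ∈ openOrthant d) (j : Fin d) (k : ℕ) :
    Integrable (fun n : Fin d → ℕ => ((n j : ℝ) / m - x j) ^ k) (poissonPi m x) ∧
    ∫ n : Fin d → ℕ, ((n j : ℝ) / m - x j) ^ k ∂poissonPi m x
      = (∫ n : ℕ, ((n : ℝ) - (m * x j).toNNReal) ^ k ∂poissonMeasure (m * x j).toNNReal)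
        / m ^ k := by
  have e : ∀ n : Fin d → ℕ, ((n j : ℝ) / m - x j) ^ k
      = ((n j : ℝ) - (m * x j).toNNReal) ^ k / m ^ k := by
    intro n
    rw [Real.coe_toNNReal _ (mul_nonneg hm.le (hx j).le), ← div_pow]
    congr 1
    field_simp
  simp only [e]
  refine ⟨(integrable_comp_eval
    (μ := fun j => poissonMeasure (m * x j).toNNReal) (f := fun n : ℕ => ((n : ℝ) - (m * x j).toNNReal) ^ k)
    (integrable_sub_pow_poissonMeasure _ _ k)).div_const _, ?_⟩
  rw [integral_div]
  congr 1
  exact integral_comp_eval (μ := fun j => poissonMeasure (m * x j).toNNReal) (f := fun n : ℕ => ((n : ℝ) - (m * x j).toNNReal) ^ k)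
    (Measurable.of_discrete).aestronglyMeasurable

theorem integral_sub_poissonPi (hm : 0 < m) (hx : x ∈ openOrthant d) (j : Fin d) :
    Integrable (fun n : Fin d → ℕ => (n j : ℝ) / m - x j) (poissonPi m x) ∧
    ∫ n : Fin d → ℕ, ((n j : ℝ) / m - x j) ∂poissonPi m x = 0 := by
  have h := integral_comp_eval_poissonPi hm hx j 1
  simp only [pow_one, integral_sub_poissonMeasure, zero_div] at h
  exact h

theorem integral_sub_sq_poissonPi (hm : 0 < m) (hx : x ∈ openOrthant d) (j : Fin d) :
    Integrable (fun n : Fin d → ℕ => ((n j : ℝ) / m - x j) ^ 2) (poissonPi m x) ∧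
    ∫ n : Fin d → ℕ, ((n j : ℝ) / m - x j) ^ 2 ∂poissonPi m x = x j / m := by
  have h := integral_comp_eval_poissonPi hm hx j 2
  rw [integral_sub_sq_poissonMeasure, Real.coe_toNNReal _ (mul_nonneg hm.le (hx j).le)] at h
  refine ⟨h.1, h.2.trans ?_⟩
  field_simp

theorem integral_sub_pow_four_poissonPi (hm : 0 < m) (hx : x ∈ openOrthant d) (j : Fin d) :
    Integrable (fun n : Fin d → ℕ => ((n j : ℝ) / m - x j) ^ 4) (poissonPi m x) ∧
    ∫ n : Fin d → ℕ, ((n j : ℝ) / m - x j) ^ 4 ∂poissonPi m x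
      = 3 * x j ^ 2 / m ^ 2 + x j / m ^ 3 := by
  have h := integral_comp_eval_poissonPi hm hx j 4
  rw [integral_sub_pow_four_poissonMeasure, Real.coe_toNNReal _ (mul_nonneg hm.le (hx j).le)] at h
  refine ⟨h.1, h.2.trans ?_⟩
  field_simp

theorem integral_sub_mul_sub_poissonPi (hm : 0 < m) (hx : x ∈ openOrthant d) (i j : Fin d) :
    Integrable (fun n : Fin d → ℕ => ((n i : ℝ) / m - x i) * ((n j : ℝ) / m - x j))
      (poissonPi m x) ∧
    ∫ n : Fin d → ℕ, ((n i : ℝ) / m - x i) * ((n j : ℝ) / m - x j) ∂poissonPi m x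
      = if i = j then x i / m else 0 := by
  by_cases hij : i = j
  · subst hij
    simpa [sq] using integral_sub_sq_poissonPi hm hx i
  · have hind : iIndepFun (fun (j : Fin d) (n : Fin d → ℕ) => (n j : ℝ) / m - x j)
        (poissonPi m x) :=
      iIndepFun_pi (X := fun (j : Fin d) (n : ℕ) => (n : ℝ) / m - x j)
        fun j => (Measurable.of_discrete).aemeasurable
    have hind' := hind.indepFun hij
    have hi := integral_sub_poissonPi hm hx i
    have hj := integral_sub_poissonPi hm hx j
    refine ⟨hind'.integrable_mul hi.1 hj.1, ?_⟩
    rw [hind'.integral_fun_mul_eq_mul_integral hi.1.aestronglyMeasurable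
      hj.1.aestronglyMeasurable, hi.2, if_neg hij, zero_mul]

theorem measurePreserving_eval_prod_poissonPi (m : ℝ) (x : Fin d → ℝ) (j : Fin d) :
    MeasurePreserving (fun p : (Fin d → ℕ) × (Fin d → ℕ) => (p.1 j, p.2 j))
      ((poissonPi m x).prod (poissonPi m x))
      ((poissonMeasure (m * x j).toNNReal).prod (poissonMeasure (m * x j).toNNReal)) :=
  (measurePreserving_eval _ j).prod (measurePreserving_eval _ j)

/-- Since min(a, b) = (a + b)/2 - |a - b|/2 and both copies are centred at x, only the mean absolute
difference survives. -/
theorem integral_min_sub_poissonPi (hm : 0 < m) (hx : x ∈ openOrthant d) (j : Fin d) :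
    Integrable (fun p : (Fin d → ℕ) × (Fin d → ℕ) =>
      min ((p.1 j : ℝ) / m) ((p.2 j : ℝ) / m) - x j) ((poissonPi m x).prod (poissonPi m x)) ∧
    ∫ p : (Fin d → ℕ) × (Fin d → ℕ), (min ((p.1 j : ℝ) / m) ((p.2 j : ℝ) / m) - x j)
        ∂(poissonPi m x).prod (poissonPi m x)
      = -(poissonMeanAbsDiff (m * x j).toNNReal / (2 * m)) := by
  have h := integral_sub_poissonPi hm hx j
  have i1 := h.1.comp_fst (poissonPi m x)
  have i2 := h.1.comp_snd (poissonPi m x)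
  have i3 : Integrable (fun p : (Fin d → ℕ) × (Fin d → ℕ) => |(p.1 j : ℝ) - p.2 j|)
      ((poissonPi m x).prod (poissonPi m x)) := by
    have := ((i1.sub i2).abs).const_mul m
    refine this.congr (ae_of_all _ fun p => ?_)
    simp only [Pi.sub_apply]
    rw [← abs_of_pos hm, ← abs_mul, abs_of_pos hm]
    congr 1
    field_simp
    ring
  have e3 : ∫ p : (Fin d → ℕ) × (Fin d → ℕ), |(p.1 j : ℝ) - p.2 j|
      ∂(poissonPi m x).prod (poissonPi m x) = poissonMeanAbsDiff (m * x j).toNNReal :=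
    (measurePreserving_eval_prod_poissonPi m x j).hasLaw.integral_comp
      (f := fun p : ℕ × ℕ => |(p.1 : ℝ) - p.2|) (Measurable.of_discrete).aestronglyMeasurable
  have e : ∀ p : (Fin d → ℕ) × (Fin d → ℕ), min ((p.1 j : ℝ) / m) ((p.2 j : ℝ) / m) - x j
      = (1 / 2) * (((p.1 j : ℝ) / m - x j) + ((p.2 j : ℝ) / m - x j))
        - |(p.1 j : ℝ) - p.2 j| / (2 * m) := by
    intro p
    have a : |(p.1 j : ℝ) / m - (p.2 j : ℝ) / m| = |(p.1 j : ℝ) - p.2 j| / m := by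
      rw [← sub_div, abs_div, abs_of_pos hm]
    have b : min ((p.1 j : ℝ) / m) ((p.2 j : ℝ) / m) = (1 / 2) * ((p.1 j : ℝ) / m + (p.2 j : ℝ) / m)
        - |(p.1 j : ℝ) / m - (p.2 j : ℝ) / m| / 2 := by
      rcases le_total ((p.1 j : ℝ) / m) ((p.2 j : ℝ) / m) with h | h
      · rw [min_eq_left h, abs_of_nonpos (sub_nonpos.2 h)]; ring
      · rw [min_eq_right h, abs_of_nonneg (sub_nonneg.2 h)]; ring
    rw [b, a]
    field_simp
    ring
  simp only [e]
  refine ⟨((i1.fun_add i2).const_mul _).sub (i3.div_const _), ?_⟩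
  rw [integral_sub ((i1.fun_add i2).const_mul _) (i3.div_const _), integral_const_mul,
    integral_add i1 i2, integral_div, e3,
    integral_fun_fst (fun n : Fin d → ℕ => (n j : ℝ) / m - x j),
    integral_fun_snd (fun n : Fin d → ℕ => (n j : ℝ) / m - x j), h.2]
  simp

/-- The minimum is one of the two copies, so its squared deviation is at most the sum of theirs. -/
theorem integral_min_sub_sq_poissonPi_le (hm : 0 < m) (hx : x ∈ openOrthant d) (j : Fin d) :
    Integrable (fun p : (Fin d → ℕ) × (Fin d → ℕ) =>
      (min ((p.1 j : ℝ) / m) ((p.2 j : ℝ) / m) - x j) ^ 2)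
      ((poissonPi m x).prod (poissonPi m x)) ∧
    ∫ p : (Fin d → ℕ) × (Fin d → ℕ), (min ((p.1 j : ℝ) / m) ((p.2 j : ℝ) / m) - x j) ^ 2
        ∂(poissonPi m x).prod (poissonPi m x) ≤ 2 * x j / m := by
  have h := integral_sub_sq_poissonPi hm hx j
  have i1 := h.1.comp_fst (poissonPi m x)
  have i2 := h.1.comp_snd (poissonPi m x)
  have hle : ∀ p : (Fin d → ℕ) × (Fin d → ℕ),
      (min ((p.1 j : ℝ) / m) ((p.2 j : ℝ) / m) - x j) ^ 2
        ≤ ((p.1 j : ℝ) / m - x j) ^ 2 + ((p.2 j : ℝ) / m - x j) ^ 2 := by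
    intro p
    rcases min_choice ((p.1 j : ℝ) / m) ((p.2 j : ℝ) / m) with h | h <;> rw [h]
    · exact le_add_of_nonneg_right (sq_nonneg _)
    · exact le_add_of_nonneg_left (sq_nonneg _)
  have i3 : Integrable (fun p : (Fin d → ℕ) × (Fin d → ℕ) =>
      (min ((p.1 j : ℝ) / m) ((p.2 j : ℝ) / m) - x j) ^ 2)
      ((poissonPi m x).prod (poissonPi m x)) :=
    (i1.fun_add i2).mono' (Measurable.of_discrete).aestronglyMeasurable
      (ae_of_all _ fun p => by rw [Real.norm_of_nonneg (sq_nonneg _)]; exact hle p)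
  refine ⟨i3, (integral_mono i3 (i1.add i2) hle).trans_eq ?_⟩
  simp only [Pi.add_apply]
  rw [integral_add i1 i2,
    integral_fun_fst (fun n : Fin d → ℕ => ((n j : ℝ) / m - x j) ^ 2),
    integral_fun_snd (fun n : Fin d → ℕ => ((n j : ℝ) / m - x j) ^ 2), h.2]
  simp
  ring

end Moments

end Operator

/-! ### Bias and second moment, uniformly on compact sets -/

section Expansions

variable {d : ℕ} {F : (Fin d → ℝ) → ℝ} {S : Set (Fin d → ℝ)}

theorem abs_sub_le_one (hF0 : ∀ x, 0 ≤ F x) (hF1 : ∀ x, F x ≤ 1) (x y : Fin d → ℝ) :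
    |F y - F x| ≤ 1 := by
  rw [abs_le]
  constructor <;> linarith [hF0 x, hF0 y, hF1 x, hF1 y]

theorem exists_coord_le (hS : IsCompact S) :
    ∃ R, 0 ≤ R ∧ ∀ x ∈ S, ∀ j, x j ≤ R := by
  obtain ⟨R, hR⟩ := hS.exists_bound_of_continuousOn (f := fun x : Fin d → ℝ => x) continuousOn_id
  exact ⟨|R|, abs_nonneg _, fun x hx j => (le_abs_self _).trans
    ((norm_le_pi_norm x j).trans ((hR x hx).trans (le_abs_self _)))⟩

/-- Ensures that the rates m x_j tend to infinity uniformly on S. Lowering one coordinate by δ stays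
in the closed δ-thickening, which lies in the open orthant. -/
theorem exists_le_coord (hS : IsCompact S) (hSpos : S ⊆ openOrthant d) :
    ∃ a, 0 < a ∧ ∀ x ∈ S, ∀ j, a ≤ x j := by
  obtain ⟨δ, hδ, h⟩ := hS.exists_cthickening_subset_open (isOpen_openOrthant d) hSpos
  refine ⟨δ, hδ, fun x hx j => ?_⟩
  by_contra hlt
  have hmem : x - δ • Pi.single j (1 : ℝ) ∈ Metric.cthickening δ S := by
    refine Metric.mem_cthickening_of_dist_le _ x δ S hx ?_
    rw [dist_eq_norm, sub_sub_cancel_left, norm_neg, norm_smul, Pi.norm_single]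
    simp [abs_of_pos hδ]
  have := h hmem j
  simp at this
  linarith

/-- Asymptotic bias of the Szász–Mirakyan operator, uniformly on compact sets. -/
theorem eventually_abs_bias_sub_le (hF0 : ∀ x, 0 ≤ F x) (hF1 : ∀ x, F x ≤ 1)
    (hF : ContDiffOn ℝ 2 F (openOrthant d)) (hS : IsCompact S) (hSpos : S ⊆ openOrthant d)
    {ε : ℝ} (hε : 0 < ε) :
    ∀ᶠ m : ℝ in atTop, ∀ x ∈ S,
      |∫ k, F (fun j => (k j : ℝ) / m) ∂poissonPi m x - F x - B F x / m| ≤ ε / m := by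
  obtain ⟨R, hR0, hR⟩ := exists_coord_le hS
  -- The budget ε/m is halved: this choice keeps the d second-moment terms ε' x_j/m below ε/(2m),
  -- and the lower bound on m below does the same for the fourth moments, which are O(m⁻²). The +1
  -- guards against d R = 0.
  have hε' : 0 < ε / (2 * (d * R + 1)) := by positivity
  obtain ⟨C, hC, hT⟩ := exists_partial_taylor_two_le (isOpen_openOrthant d) hF hS hSpos
    (abs_sub_le_one hF0 hF1) hε'
  set ε' := ε / (2 * (d * R + 1)) with hε'd
  filter_upwards [eventually_ge_atTop 1,
    eventually_ge_atTop (2 * d * C * (3 * R ^ 2 + R) / ε)] with m hm1 hm2 x hx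
  have hm : 0 < m := by linarith
  have hxp := hSpos hx
  have h2 := integral_sub_sq_poissonPi hm hxp
  have h4 := integral_sub_pow_four_poissonPi hm hxp
  have hc := integral_sub_mul_sub_poissonPi hm hxp
  have h1 := integral_sub_poissonPi hm hxp
  have iF : Integrable (fun k : Fin d → ℕ => F (fun j => (k j : ℝ) / m)) (poissonPi m x) :=
    Integrable.of_bound (Measurable.of_discrete).aestronglyMeasurable 1
      (ae_of_all _ fun _ => by rw [Real.norm_of_nonneg (hF0 _)]; exact hF1 _)
  have iT1 : Integrable (fun k : Fin d → ℕ =>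
      ∑ j, partialDeriv j F x * ((k j : ℝ) / m - x j)) (poissonPi m x) :=
    integrable_finsetSum _ fun j _ => (h1 j).1.const_mul _
  have iT2 : Integrable (fun k : Fin d → ℕ => (1 / 2) * ∑ i, ∑ j,
      partialDeriv i (partialDeriv j F) x * (((k i : ℝ) / m - x i) * ((k j : ℝ) / m - x j)))
      (poissonPi m x) :=
    (integrable_finsetSum _ fun i _ => integrable_finsetSum _ fun j _ =>
      (hc i j).1.const_mul _).const_mul _
  have eT1 : ∫ k : Fin d → ℕ, ∑ j, partialDeriv j F x * ((k j : ℝ) / m - x j) ∂poissonPi m x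
      = 0 := by
    rw [integral_finsetSum _ fun j _ => (h1 j).1.const_mul _]
    simp only [integral_const_mul, (h1 _).2, mul_zero, Finset.sum_const_zero]
  have eT2 : ∫ k : Fin d → ℕ, (1 / 2) * ∑ i, ∑ j,
      partialDeriv i (partialDeriv j F) x * (((k i : ℝ) / m - x i) * ((k j : ℝ) / m - x j))
      ∂poissonPi m x = B F x / m := by
    rw [integral_const_mul, integral_finsetSum _ fun i _ => integrable_finsetSum _ fun j _ =>
      (hc i j).1.const_mul _, B, mul_div_assoc, Finset.sum_div]
    congr 1
    refine Finset.sum_congr rfl fun i _ => ?_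
    rw [integral_finsetSum _ fun j _ => (hc i j).1.const_mul _]
    simp only [integral_const_mul, (hc _ _).2, mul_ite, mul_zero, Finset.sum_ite_eq,
      Finset.mem_univ, if_true]
    ring
  have iE : Integrable (fun k : Fin d → ℕ =>
      ∑ j, (ε' * ((k j : ℝ) / m - x j) ^ 2 + C * ((k j : ℝ) / m - x j) ^ 4)) (poissonPi m x) :=
    integrable_finsetSum _ fun j _ => ((h2 j).1.const_mul _).add ((h4 j).1.const_mul _)
  have eE : ∫ k : Fin d → ℕ,
      ∑ j, (ε' * ((k j : ℝ) / m - x j) ^ 2 + C * ((k j : ℝ) / m - x j) ^ 4) ∂poissonPi m x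
      = ∑ j, (ε' * (x j / m) + C * (3 * x j ^ 2 / m ^ 2 + x j / m ^ 3)) := by
    rw [integral_finsetSum _ fun j _ => ((h2 j).1.const_mul _).fun_add ((h4 j).1.const_mul _)]
    refine Finset.sum_congr rfl fun j _ => ?_
    rw [integral_add ((h2 j).1.const_mul _) ((h4 j).1.const_mul _), integral_const_mul,
      integral_const_mul, (h2 j).2, (h4 j).2]
  have key : ∫ k : Fin d → ℕ, (F (fun j => (k j : ℝ) / m) - F x
      - ∑ j, partialDeriv j F x * ((k j : ℝ) / m - x j) - (1 / 2) * ∑ i, ∑ j,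
      partialDeriv i (partialDeriv j F) x * (((k i : ℝ) / m - x i) * ((k j : ℝ) / m - x j)))
      ∂poissonPi m x
      = ∫ k, F (fun j => (k j : ℝ) / m) ∂poissonPi m x - F x - B F x / m := by
    have i1 := integrable_fun_sub iF (integrable_const (F x))
    rw [integral_sub (integrable_fun_sub i1 iT1) iT2, integral_sub i1 iT1,
      integral_sub iF (integrable_const _), eT1, eT2]
    simp
  rw [← key]
  have hbound := norm_integral_le_of_norm_le iE
    (ae_of_all _ fun k : Fin d → ℕ =>
      (Real.norm_eq_abs _).trans_le (hT x hx (fun j => (k j : ℝ) / m)))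
  rw [eE, Real.norm_eq_abs] at hbound
  refine hbound.trans ?_
  have hterm : ∀ j : Fin d, ε' * (x j / m) + C * (3 * x j ^ 2 / m ^ 2 + x j / m ^ 3)
      ≤ ε' * (R / m) + C * (3 * R ^ 2 / m ^ 2 + R / m ^ 2) := by
    intro j
    have hxj := (hxp j).le
    have hxR := hR x hx j
    have hm23 : m ^ 2 ≤ m ^ 3 := pow_le_pow_right₀ hm1 (by norm_num)
    gcongr
  refine (Finset.sum_le_sum fun j _ => hterm j).trans ?_
  rw [Finset.sum_const, Finset.card_univ, Fintype.card_fin, nsmul_eq_mul]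
  have a1 : d * (ε' * (R / m)) ≤ ε / 2 / m := by
    have : (d : ℝ) * (ε' * (R / m)) = (d * R) / (d * R + 1) * (ε / 2 / m) := by
      rw [hε'd]; field_simp
    rw [this]
    refine mul_le_of_le_one_left (by positivity) ?_
    rw [div_le_one (by positivity)]
    linarith
  have a2 : d * (C * (3 * R ^ 2 / m ^ 2 + R / m ^ 2)) ≤ ε / 2 / m := by
    rw [div_le_iff₀ hε] at hm2
    have : (d : ℝ) * (C * (3 * R ^ 2 / m ^ 2 + R / m ^ 2))
        = (2 * d * C * (3 * R ^ 2 + R)) / (2 * m ^ 2) := by field_simp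
    rw [this, div_le_div_iff₀ (by positivity) hm]
    nlinarith
  calc _ = d * (ε' * (R / m)) + d * (C * (3 * R ^ 2 / m ^ 2 + R / m ^ 2)) := by ring
    _ ≤ ε / 2 / m + ε / 2 / m := add_le_add a1 a2
    _ = ε / m := by ring

/-- Asymptotic second moment of the smoothed indicator, uniformly on compact sets. -/
theorem eventually_abs_second_moment_sub_le (hF0 : ∀ x, 0 ≤ F x) (hF1 : ∀ x, F x ≤ 1)
    (hF : ContDiffOn ℝ 2 F (openOrthant d)) (hS : IsCompact S) (hSpos : S ⊆ openOrthant d)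
    {ε : ℝ} (hε : 0 < ε) :
    ∀ᶠ m : ℝ in atTop, ∀ x ∈ S,
      |∫ p : (Fin d → ℕ) × (Fin d → ℕ), F (fun j => min ((p.1 j : ℝ) / m) ((p.2 j : ℝ) / m))
          ∂(poissonPi m x).prod (poissonPi m x) - F x + V F x / √m| ≤ ε / √m := by
  obtain ⟨R, hR0, hR⟩ := exists_coord_le hS
  obtain ⟨a, ha, hxa⟩ := exists_le_coord hS hSpos
  obtain ⟨C, hC, hT⟩ := exists_partial_taylor_one_le (isOpen_openOrthant d) hF hS hSpos
    (abs_sub_le_one hF0 hF1)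
  have hM : ∀ j, ∃ M, ∀ x ∈ S, ‖partialDeriv j F x‖ ≤ M := fun j =>
    hS.exists_bound_of_continuousOn
      ((continuousOn_partialDeriv (isOpen_openOrthant d) hF j).mono hSpos)
  choose M hM using hM
  -- Here ε' is the tolerance in the Poisson limit. Each coordinate multiplies it by |∂_jF| ≤ |M j|
  -- and by √(x_j)/2 ≤ (R + 1)/2, so the total stays below ε/2.
  have hε' : 0 < ε / (∑ j, |M j| * (R + 1) + 1) := by positivity
  set ε' := ε / (∑ j, |M j| * (R + 1) + 1) with hε'd
  obtain ⟨r₀, hr₀⟩ := Metric.tendsto_atTop.1 tendsto_poissonMeanAbsDiff_div_sqrt ε' hε'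
  filter_upwards [eventually_gt_atTop 0, eventually_ge_atTop (r₀ / a),
    Real.tendsto_sqrt_atTop.eventually_ge_atTop (4 * d * C * R / ε)] with m hm hmr hms x hx
  have hxp := hSpos hx
  have hs : 0 < √m := Real.sqrt_pos.2 hm
  have hss : √m * √m = m := Real.mul_self_sqrt hm.le
  have h2 := integral_min_sub_sq_poissonPi_le hm hxp
  have h1 := integral_min_sub_poissonPi hm hxp
  have iF : Integrable (fun p : (Fin d → ℕ) × (Fin d → ℕ) =>
      F (fun j => min ((p.1 j : ℝ) / m) ((p.2 j : ℝ) / m)))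
      ((poissonPi m x).prod (poissonPi m x)) :=
    Integrable.of_bound (Measurable.of_discrete).aestronglyMeasurable 1
      (ae_of_all _ fun _ => by rw [Real.norm_of_nonneg (hF0 _)]; exact hF1 _)
  have iT1 : Integrable (fun p : (Fin d → ℕ) × (Fin d → ℕ) =>
      ∑ j, partialDeriv j F x * (min ((p.1 j : ℝ) / m) ((p.2 j : ℝ) / m) - x j))
      ((poissonPi m x).prod (poissonPi m x)) :=
    integrable_finsetSum _ fun j _ => (h1 j).1.const_mul _
  have eT1 : ∫ p : (Fin d → ℕ) × (Fin d → ℕ),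
      ∑ j, partialDeriv j F x * (min ((p.1 j : ℝ) / m) ((p.2 j : ℝ) / m) - x j)
      ∂(poissonPi m x).prod (poissonPi m x)
      = ∑ j, partialDeriv j F x * (-(poissonMeanAbsDiff (m * x j).toNNReal / (2 * m))) := by
    rw [integral_finsetSum _ fun j _ => (h1 j).1.const_mul _]
    simp only [integral_const_mul, (h1 _).2]
  have iE : Integrable (fun p : (Fin d → ℕ) × (Fin d → ℕ) =>
      C * ∑ j, (min ((p.1 j : ℝ) / m) ((p.2 j : ℝ) / m) - x j) ^ 2)
      ((poissonPi m x).prod (poissonPi m x)) :=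
    (integrable_finsetSum _ fun j _ => (h2 j).1).const_mul _
  have eE : ∫ p : (Fin d → ℕ) × (Fin d → ℕ),
      C * ∑ j, (min ((p.1 j : ℝ) / m) ((p.2 j : ℝ) / m) - x j) ^ 2
      ∂(poissonPi m x).prod (poissonPi m x) ≤ ε / 2 / √m := by
    rw [integral_const_mul, integral_finsetSum _ fun j _ => (h2 j).1]
    have hsum : ∑ j, ∫ p : (Fin d → ℕ) × (Fin d → ℕ),
        (min ((p.1 j : ℝ) / m) ((p.2 j : ℝ) / m) - x j) ^ 2
        ∂(poissonPi m x).prod (poissonPi m x) ≤ ∑ j : Fin d, 2 * R / m := by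
      refine Finset.sum_le_sum fun j _ => (h2 j).2.trans ?_
      have := hR x hx j
      gcongr
    rw [Finset.sum_const, Finset.card_univ, Fintype.card_fin, nsmul_eq_mul] at hsum
    refine (mul_le_mul_of_nonneg_left hsum hC).trans ?_
    rw [div_le_iff₀ hε] at hms
    rw [le_div_iff₀ hs]
    have e : C * (d * (2 * R / m)) * √m = 4 * d * C * R * √m / (2 * m) := by field_simp; ring
    rw [e, div_le_iff₀ (by positivity)]
    nlinarith
  have key : ∫ p : (Fin d → ℕ) × (Fin d → ℕ),
      (F (fun j => min ((p.1 j : ℝ) / m) ((p.2 j : ℝ) / m)) - F x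
      - ∑ j, partialDeriv j F x * (min ((p.1 j : ℝ) / m) ((p.2 j : ℝ) / m) - x j))
      ∂(poissonPi m x).prod (poissonPi m x)
      = ∫ p : (Fin d → ℕ) × (Fin d → ℕ), F (fun j => min ((p.1 j : ℝ) / m) ((p.2 j : ℝ) / m))
          ∂(poissonPi m x).prod (poissonPi m x) - F x
        + ∑ j, partialDeriv j F x * (poissonMeanAbsDiff (m * x j).toNNReal / (2 * m)) := by
    have i1 := integrable_fun_sub iF (integrable_const (F x))
    rw [integral_sub i1 iT1, integral_sub iF (integrable_const _), eT1]
    simp only [integral_const, probReal_univ, smul_eq_mul, one_mul, mul_neg, Finset.sum_neg_distrib,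
      sub_neg_eq_add]
  have hbound := (norm_integral_le_of_norm_le iE (ae_of_all _
    fun p : (Fin d → ℕ) × (Fin d → ℕ) =>
      (Real.norm_eq_abs _).trans_le
        (hT x hx (fun j => min ((p.1 j : ℝ) / m) ((p.2 j : ℝ) / m))))).trans eE
  rw [key, Real.norm_eq_abs] at hbound
  have hmad : ∀ j, |poissonMeanAbsDiff (m * x j).toNNReal / (2 * m) - √(x j / Real.pi) / √m|
      ≤ ε' / 2 * (R + 1) / √m := by
    intro j
    have hxj : 0 < x j := hxp j
    have hmx : 0 < m * x j := mul_pos hm hxj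
    have hr : r₀ ≤ (m * x j).toNNReal := by
      rw [← NNReal.coe_le_coe, Real.coe_toNNReal _ hmx.le]
      rw [div_le_iff₀ ha] at hmr
      exact hmr.trans (mul_le_mul_of_nonneg_left (hxa x hx j) hm.le)
    have h := hr₀ _ hr
    rw [Real.dist_eq, Real.coe_toNNReal _ hmx.le, Real.sqrt_mul hm.le] at h
    set D := poissonMeanAbsDiff (m * x j).toNNReal
    have hsx : 0 < √(x j) := Real.sqrt_pos.2 hxj
    have hpi : 0 < √Real.pi := Real.sqrt_pos.2 Real.pi_pos
    have hsR : √(x j) ≤ R + 1 := by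
      refine Real.sqrt_le_iff.2 ⟨by linarith, ?_⟩
      nlinarith [hR x hx j]
    -- Factoring out √(x_j)/(2√m) exposes the quantity controlled by the limit 2/√π at rate m x_j ≥
    -- r₀.
    have e : D / (2 * m) - √(x j / Real.pi) / √m
        = (D / (√m * √(x j)) - 2 / √Real.pi) * (√(x j) / (2 * √m)) := by
      rw [Real.sqrt_div hxj.le, show 2 * m = 2 * (√m * √m) by rw [hss]]
      field_simp
    rw [e, abs_mul, abs_of_pos (show 0 < √(x j) / (2 * √m) by positivity)]
    calc |D / (√m * √(x j)) - 2 / √Real.pi| * (√(x j) / (2 * √m))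
        ≤ ε' * ((R + 1) / (2 * √m)) := by gcongr
      _ = ε' / 2 * (R + 1) / √m := by field_simp
  have hV : |V F x / √m
      - ∑ j, partialDeriv j F x * (poissonMeanAbsDiff (m * x j).toNNReal / (2 * m))|
      ≤ ε / 2 / √m := by
    rw [V, Finset.sum_div, ← Finset.sum_sub_distrib]
    refine (Finset.abs_sum_le_sum_abs _ _).trans ?_
    have hterm : ∀ j, |partialDeriv j F x * √(x j / Real.pi) / √m
        - partialDeriv j F x * (poissonMeanAbsDiff (m * x j).toNNReal / (2 * m))|
        ≤ |M j| * (ε' / 2 * (R + 1) / √m) := by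
      intro j
      rw [mul_div_assoc, ← mul_sub, abs_mul, abs_sub_comm (√(x j / Real.pi) / √m)]
      exact mul_le_mul ((hM j x hx).trans (le_abs_self _)) (hmad j) (abs_nonneg _)
        (abs_nonneg _)
    refine (Finset.sum_le_sum fun j _ => hterm j).trans ?_
    have e : ∑ j, |M j| * (ε' / 2 * (R + 1) / √m)
        = (∑ j, |M j| * (R + 1)) / (∑ j, |M j| * (R + 1) + 1) * (ε / 2 / √m) := by
      rw [← Finset.sum_mul, ← Finset.sum_mul, hε'd, ← Finset.sum_mul]
      field_simp
    rw [e]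
    refine mul_le_of_le_one_left (by positivity) ?_
    rw [div_le_one (by positivity)]
    linarith
  have e2 : ε / √m = ε / 2 / √m + ε / 2 / √m := by ring
  rw [abs_le] at *
  constructor <;> linarith [hbound.1, hbound.2, hV.1, hV.2]

end Expansions

/-! ### Integrated variance and squared bias -/

section IntegratedExpansions

variable {d : ℕ} {μ : Measure (Fin d → ℝ)} [IsProbabilityMeasure μ] {S : Set (Fin d → ℝ)}

/-- The integrated variance factor of the Szász–Mirakyan estimator. -/
def varianceTerm (μ : Measure (Fin d → ℝ)) (S : Set (Fin d → ℝ)) (m : ℝ) : ℝ :=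
  ∫ x in S, (∫ y, smoothIndicator m x y ^ 2 ∂μ - (∫ y, smoothIndicator m x y ∂μ) ^ 2)

/-- The integrated squared bias of the Szász–Mirakyan estimator. -/
def biasTerm (μ : Measure (Fin d → ℝ)) (S : Set (Fin d → ℝ)) (m : ℝ) : ℝ :=
  ∫ x in S, (∫ y, smoothIndicator m x y ∂μ - jointCDF μ x) ^ 2

theorem IMSE_estimator {Ω : Type*} [MeasurableSpace Ω] {P : Measure Ω} [IsProbabilityMeasure P]
    {X : ℕ → Ω → Fin d → ℝ} (hlaw : ∀ i, HasLaw (X i) μ P) (hindep : iIndepFun X P)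
    (hS : IsCompact S) (hSpos : S ⊆ openOrthant d) {n : ℕ} (hn : 0 < n) {m : ℝ} (hm : 0 < m) :
    IMSE P S (jointCDF μ) (estimator X (fun _ => m) n)
      = (n : ℝ)⁻¹ * varianceTerm μ S m + biasTerm μ S m := by
  rw [IMSE_congr P hS.measurableSet (jointCDF μ)
    (G' := fun ω x => (1 / (n : ℝ)) * ∑ i ∈ Finset.range n, smoothIndicator m x (X i ω))
    fun ω x hx => estimator_eq X hm n ω (hSpos hx)]
  exact IMSE_sampleMean hlaw hindep hS (measurable_jointCDF μ) (jointCDF_nonneg μ)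
    (jointCDF_le_one μ) (measurable_smoothIndicator m) (smoothIndicator_nonneg m)
    (smoothIndicator_le_one m) hn

theorem integral_mem_unitInterval {α : Type*} [MeasurableSpace α] {ν : Measure α}
    [IsProbabilityMeasure ν] {f : α → ℝ} (hf : Measurable f) (h0 : ∀ x, 0 ≤ f x)
    (h1 : ∀ x, f x ≤ 1) : 0 ≤ ∫ x, f x ∂ν ∧ ∫ x, f x ∂ν ≤ 1 := by
  refine ⟨integral_nonneg h0, ?_⟩
  have hi : Integrable f ν := Integrable.of_bound hf.aestronglyMeasurable 1
    (ae_of_all _ fun x => by rw [Real.norm_of_nonneg (h0 x)]; exact h1 x)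
  simpa using integral_mono hi (integrable_const (μ := ν) (1 : ℝ)) h1

theorem measurable_integral_smoothIndicator (m : ℝ) :
    Measurable fun x => ∫ y, smoothIndicator m x y ∂μ :=
  (measurable_smoothIndicator m).stronglyMeasurable.integral_prod_right.measurable

theorem integral_smoothIndicator_mem (m : ℝ) (x : Fin d → ℝ) :
    0 ≤ ∫ y, smoothIndicator m x y ∂μ ∧ ∫ y, smoothIndicator m x y ∂μ ≤ 1 :=
  integral_mem_unitInterval (measurable_smoothIndicator m).of_uncurry_left
    (smoothIndicator_nonneg m x) (smoothIndicator_le_one m x)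

theorem integrableOn_variance (hS : IsCompact S) (m : ℝ) :
    IntegrableOn (fun x => ∫ y, smoothIndicator m x y ^ 2 ∂μ
      - (∫ y, smoothIndicator m x y ∂μ) ^ 2) S := by
  have hm2 : Measurable fun x => ∫ y, smoothIndicator m x y ^ 2 ∂μ :=
    ((measurable_smoothIndicator m).pow_const 2).stronglyMeasurable.integral_prod_right.measurable
  refine Measure.integrableOn_of_bounded (M := 1) hS.measure_lt_top.ne
    (hm2.sub ((measurable_integral_smoothIndicator m).pow_const 2)).aestronglyMeasurable
    (ae_of_all _ fun x => ?_)
  have h := integral_smoothIndicator_mem (μ := μ) m x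
  have h2 := integral_mem_unitInterval (ν := μ)
    ((measurable_smoothIndicator m).of_uncurry_left.pow_const 2 :
      Measurable fun y => smoothIndicator m x y ^ 2) (fun y => sq_nonneg _)
    (fun y => pow_le_one₀ (smoothIndicator_nonneg m x y) (smoothIndicator_le_one m x y))
  have h3 := pow_le_one₀ (n := 2) h.1 h.2
  have h4 := sq_nonneg (∫ y, smoothIndicator m x y ∂μ)
  rw [Real.norm_eq_abs, abs_le]
  constructor <;> linarith [h2.1, h2.2]

theorem integrableOn_bias_sq (hS : IsCompact S) (m : ℝ) :
    IntegrableOn (fun x => (∫ y, smoothIndicator m x y ∂μ - jointCDF μ x) ^ 2) S := by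
  refine Measure.integrableOn_of_bounded (M := 1) hS.measure_lt_top.ne
    (((measurable_integral_smoothIndicator m).sub
      (measurable_jointCDF μ)).pow_const 2).aestronglyMeasurable (ae_of_all _ fun x => ?_)
  have h := integral_smoothIndicator_mem (μ := μ) m x
  have h0 := jointCDF_nonneg μ x
  have h1 := jointCDF_le_one μ x
  rw [norm_pow, sq_le_one_iff₀ (norm_nonneg _), Real.norm_eq_abs, abs_le]
  constructor <;> linarith [h.1, h.2]

/-- The crude O(1/m) bound: it makes the squared mean negligible at order m^{-1/2} in the variance,
and linearises the difference of squares in the bias term. -/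
theorem eventually_abs_bias_le (hF : ContDiffOn ℝ 2 (jointCDF μ) (openOrthant d))
    (hS : IsCompact S) (hSpos : S ⊆ openOrthant d) :
    ∃ K, 0 ≤ K ∧ (∀ x ∈ S, |B (jointCDF μ) x| ≤ K) ∧ ∀ᶠ m : ℝ in atTop, ∀ x ∈ S,
      |∫ y, smoothIndicator m x y ∂μ - jointCDF μ x| ≤ (K + 1) / m := by
  obtain ⟨K, hK⟩ := hS.exists_bound_of_continuousOn
    ((continuousOn_B (isOpen_openOrthant d) hF).mono hSpos)
  refine ⟨|K|, abs_nonneg _, fun x hx => (hK x hx).trans (le_abs_self _), ?_⟩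
  filter_upwards [eventually_gt_atTop 0, eventually_abs_bias_sub_le (jointCDF_nonneg μ)
    (jointCDF_le_one μ) hF hS hSpos one_pos] with m hm h x hx
  have h1 := h x hx
  rw [← integral_smoothIndicator μ] at h1
  have h2 : |B (jointCDF μ) x / m| ≤ |K| / m := by
    rw [abs_div, abs_of_pos hm]
    have := (hK x hx).trans (le_abs_self _)
    rw [Real.norm_eq_abs] at this
    gcongr
  rw [add_div]
  rw [abs_le] at *
  constructor <;> linarith [h1.1, h1.2, h2.1, h2.2]

/-- Chooses a pointwise tolerance whose integral over S is at most ε, even when S is null. -/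
theorem exists_pos_mul_le (v : ℝ) {ε : ℝ} (hε : 0 < ε) : ∃ η > 0, η * |v| ≤ ε := by
  refine ⟨ε / (|v| + 1), by positivity, ?_⟩
  rw [div_mul_eq_mul_div, div_le_iff₀ (by positivity)]
  nlinarith [abs_nonneg v]

theorem eventually_abs_varianceTerm_sub_le (hF : ContDiffOn ℝ 2 (jointCDF μ) (openOrthant d))
    (hS : IsCompact S) (hSpos : S ⊆ openOrthant d) {ε : ℝ} (hε : 0 < ε) :
    ∀ᶠ m : ℝ in atTop, |varianceTerm μ S m - (∫ x in S, sigmaSq (jointCDF μ) x)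
      + (∫ x in S, V (jointCDF μ) x) / √m| ≤ ε / √m := by
  obtain ⟨η, hη, hηε⟩ := exists_pos_mul_le (volume.real S) hε
  obtain ⟨K, hK0, -, hK⟩ := eventually_abs_bias_le hF hS hSpos
  filter_upwards [eventually_gt_atTop 0, hK, eventually_abs_second_moment_sub_le
    (jointCDF_nonneg μ) (jointCDF_le_one μ) hF hS hSpos (half_pos hη),
    Real.tendsto_sqrt_atTop.eventually_ge_atTop (4 * (K + 1) / η)] with m hm hb h2 hms
  have hs : 0 < √m := Real.sqrt_pos.2 hm
  have hss : √m * √m = m := Real.mul_self_sqrt hm.le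
  have iσ : IntegrableOn (sigmaSq (jointCDF μ)) S :=
    ((continuousOn_sigmaSq hF).mono hSpos).integrableOn_compact hS
  have iV : IntegrableOn (V (jointCDF μ)) S :=
    ((continuousOn_V (isOpen_openOrthant d) hF).mono hSpos).integrableOn_compact hS
  have iA := integrableOn_variance (μ := μ) hS m
  have heq : varianceTerm μ S m - (∫ x in S, sigmaSq (jointCDF μ) x)
      + (∫ x in S, V (jointCDF μ) x) / √m
      = ∫ x in S, (∫ y, smoothIndicator m x y ^ 2 ∂μ - (∫ y, smoothIndicator m x y ∂μ) ^ 2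
        - sigmaSq (jointCDF μ) x + V (jointCDF μ) x / √m) := by
    rw [integral_add (integrable_fun_sub iA iσ) (iV.div_const _), integral_sub iA iσ,
      integral_div, varianceTerm]
  rw [heq]
  have hpt : ∀ x ∈ S, ‖∫ y, smoothIndicator m x y ^ 2 ∂μ - (∫ y, smoothIndicator m x y ∂μ) ^ 2
      - sigmaSq (jointCDF μ) x + V (jointCDF μ) x / √m‖ ≤ η / √m := by
    intro x hx
    have a1 := h2 x hx
    rw [← integral_smoothIndicator_sq μ] at a1
    have a2 := hb x hx
    have a3 := integral_smoothIndicator_mem (μ := μ) m x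
    have a4 := jointCDF_nonneg μ x
    have a5 := jointCDF_le_one μ x
    set G := ∫ y, smoothIndicator m x y ∂μ
    -- As G + F ≤ 2, the difference is at most 2(K + 1)/m, and √m ≥ 4(K + 1)/η turns this into half
    -- of the tolerance η/√m.
    have a6 : |G ^ 2 - jointCDF μ x ^ 2| ≤ η / 2 / √m := by
      have e : G ^ 2 - jointCDF μ x ^ 2 = (G - jointCDF μ x) * (G + jointCDF μ x) := by ring
      rw [e, abs_mul, abs_of_nonneg (add_nonneg a3.1 a4)]
      calc |G - jointCDF μ x| * (G + jointCDF μ x) ≤ (K + 1) / m * 2 :=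
            mul_le_mul a2 (by linarith [a3.2]) (add_nonneg a3.1 a4) (by positivity)
        _ ≤ η / 2 / √m := by
            rw [div_le_iff₀ hη] at hms
            rw [le_div_iff₀ hs]
            have e : (K + 1) / m * 2 * √m = 2 * (K + 1) / √m := by
              rw [div_mul_eq_mul_div, div_mul_eq_mul_div, div_eq_div_iff hm.ne' hs.ne', ← hss,
                hss]
              linear_combination (2 * (K + 1)) * hss
            rw [e, div_le_iff₀ hs]
            linarith
    rw [Real.norm_eq_abs, sigmaSq]
    have e2 : η / √m = η / 2 / √m + η / 2 / √m := by ring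
    rw [abs_le] at *
    constructor <;> nlinarith [a1.1, a1.2, a6.1, a6.2]
  refine (norm_setIntegral_le_of_norm_le_const hS.measure_lt_top hpt).trans ?_
  rw [abs_of_nonneg measureReal_nonneg] at hηε
  rw [div_mul_eq_mul_div]
  gcongr

theorem eventually_abs_biasTerm_sub_le (hF : ContDiffOn ℝ 2 (jointCDF μ) (openOrthant d))
    (hS : IsCompact S) (hSpos : S ⊆ openOrthant d) {ε : ℝ} (hε : 0 < ε) :
    ∀ᶠ m : ℝ in atTop, |biasTerm μ S m - (∫ x in S, B (jointCDF μ) x ^ 2) / m ^ 2|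
      ≤ ε / m ^ 2 := by
  obtain ⟨η, hη, hηε⟩ := exists_pos_mul_le (volume.real S) hε
  obtain ⟨K, hK0, hBK, hK⟩ := eventually_abs_bias_le hF hS hSpos
  -- In the factorisation of G² - (B/m)² the sum is at most (2K + 1)/m, which this denominator
  -- cancels.
  have hη' : 0 < η / (2 * K + 1) := by positivity
  filter_upwards [eventually_gt_atTop 0, hK, eventually_abs_bias_sub_le
    (jointCDF_nonneg μ) (jointCDF_le_one μ) hF hS hSpos hη'] with m hm hb h1
  have iB : IntegrableOn (fun x => B (jointCDF μ) x ^ 2) S := ContinuousOn.integrableOn_compact hS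
    (((continuousOn_B (isOpen_openOrthant d) hF).mono hSpos).pow 2)
  have iA := integrableOn_bias_sq (μ := μ) hS m
  rw [biasTerm, ← integral_div, ← integral_sub iA (iB.div_const _)]
  have hpt : ∀ x ∈ S, ‖(∫ y, smoothIndicator m x y ∂μ - jointCDF μ x) ^ 2
      - B (jointCDF μ) x ^ 2 / m ^ 2‖ ≤ η / m ^ 2 := by
    intro x hx
    have a1 := h1 x hx
    rw [← integral_smoothIndicator μ] at a1
    have a2 := hb x hx
    have a3 : |B (jointCDF μ) x / m| ≤ K / m := by
      rw [abs_div, abs_of_pos hm]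
      have := hBK x hx
      gcongr
    set G := ∫ y, smoothIndicator m x y ∂μ - jointCDF μ x
    have e : G ^ 2 - B (jointCDF μ) x ^ 2 / m ^ 2
        = (G - B (jointCDF μ) x / m) * (G + B (jointCDF μ) x / m) := by ring
    rw [Real.norm_eq_abs, e, abs_mul]
    calc |G - B (jointCDF μ) x / m| * |G + B (jointCDF μ) x / m|
        ≤ (η / (2 * K + 1) / m) * ((K + 1) / m + K / m) := by
          refine mul_le_mul a1 ((abs_add_le _ _).trans (add_le_add a2 a3)) (abs_nonneg _)
            (by positivity)
      _ = η / m ^ 2 := by field_simp; ring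
  refine (norm_setIntegral_le_of_norm_le_const hS.measure_lt_top hpt).trans ?_
  rw [abs_of_nonneg measureReal_nonneg] at hηε
  rw [div_mul_eq_mul_div]
  gcongr

/-- A zero integral of the nonnegative V means V = 0 almost everywhere on S, hence B = 0 there,
contradicting ∫B² > 0. -/
theorem integral_V_pos (hF : ContDiffOn ℝ 2 (jointCDF μ) (openOrthant d))
    (hS : IsCompact S) (hSpos : S ⊆ openOrthant d) (hB : 0 < ∫ x in S, B (jointCDF μ) x ^ 2) :
    0 < ∫ x in S, V (jointCDF μ) x := by
  have hpt := fun x (hx : x ∈ S) => V_nonneg_and_B_eq_zero (jointCDF_mono μ) hF (hSpos hx)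
  have iV : IntegrableOn (V (jointCDF μ)) S :=
    ((continuousOn_V (isOpen_openOrthant d) hF).mono hSpos).integrableOn_compact hS
  have h0 : 0 ≤ᵐ[volume.restrict S] V (jointCDF μ) :=
    (ae_restrict_mem hS.measurableSet).mono fun x hx => (hpt x hx).1
  refine lt_of_le_of_ne (integral_nonneg_of_ae h0) fun h => hB.ne' ?_
  have hae := (integral_eq_zero_iff_of_nonneg_ae h0 iV).1 h.symm
  refine integral_eq_zero_of_ae ?_
  filter_upwards [hae, ae_restrict_mem hS.measurableSet] with x hx hxS
  simp [(hpt x hxS).2 hx]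

end IntegratedExpansions

/-! ### The quartic risk and its stability under perturbation -/

section Optimisation

/-- The rescaled leading terms of the integrated mean squared error. -/
def quarticRisk (v b s : ℝ) : ℝ := -(v * s) + b * s ^ 4

/-- The relation v = 4 b s₀³ says that s₀ is critical, so (s - s₀)² divides the excess; the cofactor
is explicit. -/
theorem quarticRisk_sub {v b s₀ : ℝ} (h : v = 4 * b * s₀ ^ 3) (s : ℝ) :
    quarticRisk v b s - quarticRisk v b s₀
      = b * (s - s₀) ^ 2 * (s ^ 2 + 2 * s * s₀ + 3 * s₀ ^ 2) := by
  subst h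
  unfold quarticRisk
  ring

theorem le_quarticRisk_sub {v b s₀ : ℝ} (hb : 0 < b) (hs₀ : 0 < s₀) (h : v = 4 * b * s₀ ^ 3)
    {s : ℝ} (hs : 0 ≤ s) :
    3 * b * s₀ ^ 2 * (s - s₀) ^ 2 ≤ quarticRisk v b s - quarticRisk v b s₀ := by
  rw [quarticRisk_sub h]
  have : 3 * b * s₀ ^ 2 * (s - s₀) ^ 2 = b * (s - s₀) ^ 2 * (3 * s₀ ^ 2) := by ring
  rw [this]
  refine mul_le_mul_of_nonneg_left ?_ (by positivity)
  have : 0 ≤ s ^ 2 + 2 * s * s₀ := by positivity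
  linarith

/-- Coercivity: it lets the relative error ε(s + s⁴) be absorbed by the excess risk without knowing
that s is bounded. -/
theorem exists_add_pow_le_quarticRisk {v b s₀ : ℝ} (hb : 0 < b) (hs₀ : 0 < s₀)
    (h : v = 4 * b * s₀ ^ 3) :
    ∃ a c : ℝ, 0 < a ∧ 0 < c ∧ ∀ s, 0 ≤ s →
      s + s ^ 4 ≤ a + c * (quarticRisk v b s - quarticRisk v b s₀) := by
  have hval : quarticRisk v b s₀ = -(3 * b * s₀ ^ 4) := by subst h; unfold quarticRisk; ring
  -- Young's inequality spends b/4 of the coefficient of s⁴ on the term v s. The factor 8/(3b) turns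
  -- the remaining (3b/4) s⁴ into 2 s⁴, which with s ≤ 1 + s⁴ controls s + s⁴.
  refine ⟨1 + (8 / (3 * b)) * (v ^ 2 / (2 * b) + b / 4), 8 / (3 * b), by positivity,
    by positivity, fun s hs => ?_⟩
  have h1 : v * s ≤ v ^ 2 / (2 * b) + b / 2 * s ^ 2 := by
    have e : v ^ 2 / (2 * b) + b / 2 * s ^ 2 - v * s = (v - b * s) ^ 2 / (2 * b) := by
      field_simp
      ring
    have : 0 ≤ (v - b * s) ^ 2 / (2 * b) := by positivity
    linarith
  have h2 : s ^ 2 ≤ (1 + s ^ 4) / 2 := by nlinarith [sq_nonneg (s ^ 2 - 1)]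
  have h3 : b / 2 * s ^ 2 ≤ b / 2 * ((1 + s ^ 4) / 2) := by gcongr
  have h4 : s ≤ 1 + s ^ 4 := by nlinarith [sq_nonneg (s - 1)]
  have h5 : 3 * b / 4 * s ^ 4 ≤ v ^ 2 / (2 * b) + b / 4
      + (quarticRisk v b s - quarticRisk v b s₀) := by
    rw [hval]
    unfold quarticRisk
    have : 0 ≤ 3 * b * s₀ ^ 4 := by positivity
    linarith
  have h6 : 2 * s ^ 4 = (8 / (3 * b)) * (3 * b / 4 * s ^ 4) := by field_simp; ring
  have h7 := mul_le_mul_of_nonneg_left h5 (show 0 ≤ 8 / (3 * b) by positivity)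
  linarith

section Sequences

variable {v b s₀ : ℝ} {s g : ℕ → ℝ}

theorem tendsto_quarticRisk_of_tendsto
    (hg : ∀ ε > 0, ∀ᶠ n in atTop, |g n - quarticRisk v b (s n)| ≤ ε * (s n + s n ^ 4))
    (hs : Tendsto s atTop (𝓝 s₀)) : Tendsto g atTop (𝓝 (quarticRisk v b s₀)) := by
  have hc : Tendsto (fun n => quarticRisk v b (s n)) atTop (𝓝 (quarticRisk v b s₀)) := by
    have : Continuous (quarticRisk v b) := by unfold quarticRisk; fun_prop
    exact (this.tendsto s₀).comp hs
  have hq : Tendsto (fun n => s n + s n ^ 4) atTop (𝓝 (s₀ + s₀ ^ 4)) := hs.add (hs.pow 4)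
  have hbd : ∀ᶠ n in atTop, s n + s n ^ 4 ≤ |s₀ + s₀ ^ 4| + 1 :=
    hq.eventually_le_const (by linarith [le_abs_self (s₀ + s₀ ^ 4)])
  have hd : Tendsto (fun n => g n - quarticRisk v b (s n)) atTop (𝓝 0) := by
    rw [Metric.tendsto_nhds]
    intro ε hε
    filter_upwards [hg (ε / 2 / (|s₀ + s₀ ^ 4| + 1)) (by positivity), hbd] with n h1 h2
    rw [Real.dist_eq, sub_zero]
    refine lt_of_le_of_lt (h1.trans (mul_le_mul_of_nonneg_left h2 (by positivity))) ?_
    rw [div_mul_cancel₀ _ (by positivity)]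
    linarith
  simpa using hd.add hc

/-- Half of the excess survives the perturbation. This single lower bound yields both the optimality
of s₀ and the necessity of convergence to it. -/
theorem eventually_quarticRisk_le (hb : 0 < b) (hs₀ : 0 < s₀) (h : v = 4 * b * s₀ ^ 3)
    (hg : ∀ ε > 0, ∀ᶠ n in atTop, |g n - quarticRisk v b (s n)| ≤ ε * (s n + s n ^ 4))
    (hs : ∀ᶠ n in atTop, 0 ≤ s n) {ε : ℝ} (hε : 0 < ε) :
    ∀ᶠ n in atTop, (quarticRisk v b (s n) - quarticRisk v b s₀) / 2 - ε
      ≤ g n - quarticRisk v b s₀ := by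
  obtain ⟨a, c, ha, hc, hac⟩ := exists_add_pow_le_quarticRisk hb hs₀ h
  have hη : 0 < min (1 / (2 * c)) (ε / a) := by positivity
  filter_upwards [hg _ hη, hs] with n h1 h2
  have h3 := hac (s n) h2
  have h4 : 0 ≤ quarticRisk v b (s n) - quarticRisk v b s₀ :=
    le_trans (by positivity) (le_quarticRisk_sub hb hs₀ h h2)
  set p := quarticRisk v b (s n) - quarticRisk v b s₀ with hp
  set η := min (1 / (2 * c)) (ε / a)
  have h5 : η * a ≤ ε := by
    have := min_le_right (1 / (2 * c)) (ε / a)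
    rwa [← le_div_iff₀ ha]
  have h6 : η * c ≤ 1 / 2 := by
    have := min_le_left (1 / (2 * c)) (ε / a)
    rw [← le_div_iff₀ hc]
    exact this.trans_eq (by field_simp)
  have h7 : η * (s n + s n ^ 4) ≤ ε + p / 2 := by
    calc η * (s n + s n ^ 4) ≤ η * (a + c * p) := by gcongr
      _ = η * a + η * c * p := by ring
      _ ≤ ε + 1 / 2 * p := by gcongr
      _ = ε + p / 2 := by ring
  have h8 := (abs_le.1 h1).1
  linarith

theorem tendsto_of_tendsto_quarticRisk (hb : 0 < b) (hs₀ : 0 < s₀) (h : v = 4 * b * s₀ ^ 3)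
    (hg : ∀ ε > 0, ∀ᶠ n in atTop, |g n - quarticRisk v b (s n)| ≤ ε * (s n + s n ^ 4))
    (hs : ∀ᶠ n in atTop, 0 ≤ s n) (hlim : Tendsto g atTop (𝓝 (quarticRisk v b s₀))) :
    Tendsto s atTop (𝓝 s₀) := by
  rw [Metric.tendsto_nhds]
  intro ε hε
  -- This is the least excess forced by |s - s₀| ≥ ε. Two errors of a quarter of it, doubled because
  -- only half of the excess is retained, fall just short of it.
  have hk : 0 < 3 * b * s₀ ^ 2 * ε ^ 2 := by positivity
  filter_upwards [eventually_quarticRisk_le hb hs₀ h hg hs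
      (show 0 < 3 * b * s₀ ^ 2 * ε ^ 2 / 4 by positivity), hs,
    hlim.eventually_lt_const (lt_add_of_pos_right (quarticRisk v b s₀)
      (show 0 < 3 * b * s₀ ^ 2 * ε ^ 2 / 4 by positivity))] with n h1 h2 h3
  have h4 := le_quarticRisk_sub hb hs₀ h h2
  rw [Real.dist_eq]
  refine abs_lt_of_sq_lt_sq ?_ hε.le
  have h5 : 3 * b * s₀ ^ 2 * (s n - s₀) ^ 2 < 3 * b * s₀ ^ 2 * ε ^ 2 := by linarith
  exact lt_of_mul_lt_mul_left h5 (by positivity)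

end Sequences

/-! ### Change of variable from smoothing level to scale -/

theorem rpow_third_pow (n : ℕ) : ((n : ℝ) ^ (1 / 3 : ℝ)) ^ 3 = n := by
  rw [← Real.rpow_natCast, ← Real.rpow_mul (Nat.cast_nonneg n)]
  norm_num

theorem rpow_two_thirds {x : ℝ} (hx : 0 ≤ x) : x ^ (2 / 3 : ℝ) = (x ^ (1 / 3 : ℝ)) ^ 2 := by
  rw [← Real.rpow_natCast, ← Real.rpow_mul hx]
  norm_num

theorem rpow_neg_four_thirds {x : ℝ} (hx : 0 ≤ x) :
    x ^ (-(4 / 3) : ℝ) = ((x ^ (1 / 3 : ℝ)) ^ 4)⁻¹ := by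
  rw [← Real.rpow_natCast, ← Real.rpow_mul hx, Real.rpow_neg hx]
  norm_num

theorem rpow_neg_half {m : ℝ} (hm : 0 < m) : m ^ (-(1 / 2) : ℝ) = 1 / √m := by
  rw [Real.rpow_neg hm.le, ← Real.sqrt_eq_rpow, one_div]

theorem rpow_neg_two {m : ℝ} (hm : 0 < m) : m ^ (-2 : ℝ) = 1 / m ^ 2 := by
  rw [Real.rpow_neg hm.le, one_div]
  norm_num

/-- The scale `n^{1/3} m^{-1/2}` in which the leading terms become a quartic polynomial. -/
def riskScale (n : ℕ) (m : ℝ) : ℝ := (n : ℝ) ^ (1 / 3 : ℝ) / √m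

/-- The optimal scale. -/
def optScale (v b : ℝ) : ℝ := (v / (4 * b)) ^ (1 / 3 : ℝ)

/-- The optimal smoothing level. -/
def optLevel (v b : ℝ) (n : ℕ) : ℝ := (n : ℝ) ^ (2 / 3 : ℝ) * (4 * b / v) ^ (2 / 3 : ℝ)

section Scale

variable {v b : ℝ}

theorem optScale_pos (hv : 0 < v) (hb : 0 < b) : 0 < optScale v b := by unfold optScale; positivity

theorem optScale_pow_three (hv : 0 < v) (hb : 0 < b) : v = 4 * b * optScale v b ^ 3 := by
  unfold optScale
  rw [← Real.rpow_natCast, ← Real.rpow_mul (by positivity)]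
  norm_num
  field_simp

theorem optLevel_eq (hv : 0 < v) (hb : 0 < b) (n : ℕ) : optLevel v b n = ((n : ℝ) ^ (1 / 3 : ℝ) / optScale v b) ^ 2 := by
  unfold optLevel optScale
  rw [rpow_two_thirds (Nat.cast_nonneg n), rpow_two_thirds (by positivity), div_pow,
    ← inv_div v (4 * b), Real.inv_rpow (by positivity), inv_pow]
  field_simp

theorem riskScale_optLevel (hv : 0 < v) (hb : 0 < b) {n : ℕ} (hn : 0 < n) : riskScale n (optLevel v b n) = optScale v b := by
  have h := optScale_pos hv hb
  have hn' : (0 : ℝ) < (n : ℝ) ^ (1 / 3 : ℝ) := by positivity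
  rw [riskScale, optLevel_eq hv hb, Real.sqrt_sq (by positivity)]
  field_simp

theorem optLevel_pos (hv : 0 < v) (hb : 0 < b) {n : ℕ} (hn : 0 < n) : 0 < optLevel v b n := by
  unfold optLevel
  positivity

theorem tendsto_optLevel (hv : 0 < v) (hb : 0 < b) : Tendsto (optLevel v b) atTop atTop := by
  have h : Tendsto (fun n : ℕ => (n : ℝ) ^ (2 / 3 : ℝ)) atTop atTop :=
    (tendsto_rpow_atTop (by norm_num)).comp tendsto_natCast_atTop_atTop
  exact h.atTop_mul_const (by positivity)

theorem div_optLevel_eq (hv : 0 < v) (hb : 0 < b) {n : ℕ} (hn : 0 < n) {m : ℝ} (hm : 0 < m) :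
    m / optLevel v b n = (optScale v b / riskScale n m) ^ 2 := by
  have h := optScale_pos hv hb
  have hn' : (0 : ℝ) < (n : ℝ) ^ (1 / 3 : ℝ) := by positivity
  have hs : 0 < √m := Real.sqrt_pos.2 hm
  rw [optLevel_eq hv hb, riskScale, div_div_eq_mul_div, div_pow, div_pow, mul_pow,
    Real.sq_sqrt hm.le]
  field_simp

end Scale

theorem riskScale_pos {n : ℕ} (hn : 0 < n) {m : ℝ} (hm : 0 < m) : 0 < riskScale n m := by
  unfold riskScale
  positivity

/-- Smoothing levels are asymptotically optimal iff their scales converge to the optimal scale. -/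
theorem tendsto_div_optLevel_iff {v b : ℝ} (hv : 0 < v) (hb : 0 < b) {m : ℕ → ℝ}
    (hm : Tendsto m atTop atTop) :
    Tendsto (fun n => m n / optLevel v b n) atTop (𝓝 1) ↔
      Tendsto (fun n => riskScale n (m n)) atTop (𝓝 (optScale v b)) := by
  have h := optScale_pos hv hb
  have hpos : ∀ᶠ n in atTop, 0 < n ∧ 0 < m n :=
    (eventually_gt_atTop 0).and (hm.eventually_gt_atTop 0)
  -- The ratio of levels is the squared inverse ratio of scales, so square roots of positive
  -- quantities transfer the limit.
  have he : (fun n => m n / optLevel v b n) =ᶠ[atTop]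
      fun n => (optScale v b / riskScale n (m n)) ^ 2 := by
    filter_upwards [hpos] with n hn
    exact div_optLevel_eq hv hb hn.1 hn.2
  rw [tendsto_congr' he]
  constructor
  · intro ht
    have h1 := (Real.continuous_sqrt.tendsto 1).comp ht
    rw [Real.sqrt_one] at h1
    have h2 : Tendsto (fun n => optScale v b /
        (Real.sqrt ∘ fun n => (optScale v b / riskScale n (m n)) ^ 2) n) atTop
        (𝓝 (optScale v b / 1)) := tendsto_const_nhds.div h1 one_ne_zero
    rw [div_one] at h2
    refine h2.congr' ?_
    filter_upwards [hpos] with n hn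
    have := riskScale_pos hn.1 hn.2
    simp only [Function.comp_apply]
    rw [Real.sqrt_sq (by positivity)]
    field_simp
  · intro ht
    have := ((tendsto_const_nhds (x := optScale v b)).div ht h.ne').pow 2
    rwa [div_self h.ne', one_pow] at this

/-! ### Optimal tuning of the risk -/

variable {A C : ℝ → ℝ} {f : ℕ → ℝ → ℝ} {σ v b : ℝ}

/-- Multiplying by n^{4/3} turns n⁻¹ m^{-1/2} into s and m⁻² into s⁴, so the two error terms become
ε s and ε s⁴. -/
theorem eventually_abs_rescaled_sub_le
    (hf : ∀ (n : ℕ) (m : ℝ), 0 < n → 0 < m → f n m = (n : ℝ)⁻¹ * A m + C m)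
    (hA : ∀ ε > 0, ∀ᶠ m : ℝ in atTop, |A m - σ + v / √m| ≤ ε / √m)
    (hC : ∀ ε > 0, ∀ᶠ m : ℝ in atTop, |C m - b / m ^ 2| ≤ ε / m ^ 2)
    {m : ℕ → ℝ} (hm : Tendsto m atTop atTop) {ε : ℝ} (hε : 0 < ε) :
    ∀ᶠ n : ℕ in atTop, |((n : ℝ) ^ (1 / 3 : ℝ)) ^ 4 * (f n (m n) - (n : ℝ)⁻¹ * σ)
      - quarticRisk v b (riskScale n (m n))|
        ≤ ε * (riskScale n (m n) + riskScale n (m n) ^ 4) := by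
  filter_upwards [eventually_gt_atTop 0, hm.eventually_gt_atTop 0, hm.eventually (hA ε hε),
    hm.eventually (hC ε hε)] with n hn hmn h1 h2
  have hq : (0 : ℝ) < (n : ℝ) ^ (1 / 3 : ℝ) := by positivity
  have hq3 := rpow_third_pow n
  rw [hf n _ hn hmn]
  set q := (n : ℝ) ^ (1 / 3 : ℝ) with hqd
  have hs : 0 < √(m n) := Real.sqrt_pos.2 hmn
  have hs4 : √(m n) ^ 4 = m n ^ 2 := by
    rw [show 4 = 2 * 2 from rfl, pow_mul, Real.sq_sqrt hmn.le]
  have e4 : riskScale n (m n) ^ 4 = q ^ 4 / m n ^ 2 := by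
    rw [riskScale, div_pow, hs4]
  have e : q ^ 4 * ((n : ℝ)⁻¹ * A (m n) + C (m n) - (n : ℝ)⁻¹ * σ)
      - quarticRisk v b (riskScale n (m n))
      = q * (A (m n) - σ + v / √(m n)) + q ^ 4 * (C (m n) - b / m n ^ 2) := by
    rw [quarticRisk, e4, riskScale, ← hqd, ← hq3]
    field_simp
    ring
  rw [e]
  refine (abs_add_le _ _).trans ?_
  rw [abs_mul, abs_mul, abs_of_pos hq, abs_of_pos (pow_pos hq 4), mul_add, e4]
  refine add_le_add ((mul_le_mul_of_nonneg_left h1 hq.le).trans_eq ?_)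
    ((mul_le_mul_of_nonneg_left h2 (by positivity)).trans_eq ?_)
  · rw [riskScale]; ring
  · ring

theorem isLittleO_rpow_neg_four_thirds_iff (u : ℕ → ℝ) :
    u =o[atTop] (fun n : ℕ => (n : ℝ) ^ (-(4 / 3) : ℝ)) ↔
      Tendsto (fun n : ℕ => ((n : ℝ) ^ (1 / 3 : ℝ)) ^ 4 * u n) atTop (𝓝 0) := by
  rw [isLittleO_iff_tendsto']
  · refine tendsto_congr fun n => ?_
    rw [rpow_neg_four_thirds (Nat.cast_nonneg n), div_inv_eq_mul, mul_comm]
  · filter_upwards [eventually_gt_atTop 0] with n hn h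
    have : (0 : ℝ) < (n : ℝ) ^ (-(4 / 3) : ℝ) := by positivity
    exact absurd h this.ne'

/-- Optimal tuning of a risk with an expansion `n⁻¹ (σ - v m^{-1/2}) + b m⁻²`. -/
theorem optimal_tuning (hv : 0 < v) (hb : 0 < b)
    (hf : ∀ (n : ℕ) (m : ℝ), 0 < n → 0 < m → f n m = (n : ℝ)⁻¹ * A m + C m)
    (hA : ∀ ε > 0, ∀ᶠ m : ℝ in atTop, |A m - σ + v / √m| ≤ ε / √m)
    (hC : ∀ ε > 0, ∀ᶠ m : ℝ in atTop, |C m - b / m ^ 2| ≤ ε / m ^ 2) :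
    (∀ m : ℕ → ℝ, Tendsto m atTop atTop → ∀ ε > 0, ∀ᶠ n : ℕ in atTop,
        f n (optLevel v b n) ≤ f n (m n) + ε * (n : ℝ) ^ (-(4 / 3) : ℝ)) ∧
    (∀ m : ℕ → ℝ, Tendsto m atTop atTop →
        ((fun n : ℕ => f n (m n) - f n (optLevel v b n))
            =o[atTop] (fun n : ℕ => (n : ℝ) ^ (-(4 / 3) : ℝ)) ↔
          Tendsto (fun n : ℕ => m n / optLevel v b n) atTop (𝓝 1))) ∧
    (fun n : ℕ => f n (optLevel v b n) -
          ((n : ℝ)⁻¹ * σ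
            - (n : ℝ) ^ (-(4 / 3) : ℝ) * (3 / 4) * (v ^ 4 / (4 * b)) ^ (1 / 3 : ℝ)))
        =o[atTop] (fun n : ℕ => (n : ℝ) ^ (-(4 / 3) : ℝ)) := by
  have hs₀ := optScale_pos hv hb
  have h3 := optScale_pow_three hv hb
  have hG := fun (m : ℕ → ℝ) (hm : Tendsto m atTop atTop) ε (hε : ε > 0) =>
    eventually_abs_rescaled_sub_le hf hA hC hm hε
  have hpos : ∀ m : ℕ → ℝ, Tendsto m atTop atTop → ∀ᶠ n in atTop, 0 ≤ riskScale n (m n) := by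
    intro m hm
    filter_upwards [eventually_gt_atTop 0, hm.eventually_gt_atTop 0] with n h1 h2
    exact (riskScale_pos h1 h2).le
  -- Along the optimal level the scale equals s₀ for every n > 0, so the rescaled risk tends to the
  -- minimum of the quartic.
  have hopt : Tendsto (fun n : ℕ => ((n : ℝ) ^ (1 / 3 : ℝ)) ^ 4
      * (f n (optLevel v b n) - (n : ℝ)⁻¹ * σ)) atTop (𝓝 (quarticRisk v b (optScale v b))) := by
    refine tendsto_quarticRisk_of_tendsto (hG _ (tendsto_optLevel hv hb)) ?_
    refine tendsto_const_nhds.congr' ?_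
    filter_upwards [eventually_gt_atTop 0] with n hn
    exact (riskScale_optLevel hv hb hn).symm
  refine ⟨fun m hm ε hε => ?_, fun m hm => ?_, ?_⟩
  · filter_upwards [eventually_gt_atTop 0, hpos m hm,
      eventually_quarticRisk_le hb hs₀ h3 (hG m hm) (hpos m hm) (half_pos hε),
      hopt.eventually_lt_const (lt_add_of_pos_right _ (half_pos hε))] with n hn h1 h2 h4
    have hq : (0 : ℝ) < ((n : ℝ) ^ (1 / 3 : ℝ)) ^ 4 := by positivity
    have h5 := le_quarticRisk_sub hb hs₀ h3 h1
    have h6 : 0 ≤ 3 * b * optScale v b ^ 2 * (riskScale n (m n) - optScale v b) ^ 2 := by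
      positivity
    rw [rpow_neg_four_thirds (Nat.cast_nonneg n), ← mul_le_mul_iff_right₀ hq, mul_add,
      mul_left_comm, mul_inv_cancel₀ hq.ne']
    rw [mul_sub] at h2 h4
    linarith
  · rw [isLittleO_rpow_neg_four_thirds_iff, tendsto_div_optLevel_iff hv hb hm]
    have e : ∀ n : ℕ, ((n : ℝ) ^ (1 / 3 : ℝ)) ^ 4 * (f n (m n) - f n (optLevel v b n))
        = ((n : ℝ) ^ (1 / 3 : ℝ)) ^ 4 * (f n (m n) - (n : ℝ)⁻¹ * σ)
          - ((n : ℝ) ^ (1 / 3 : ℝ)) ^ 4 * (f n (optLevel v b n) - (n : ℝ)⁻¹ * σ) := by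
      intro n; ring
    simp only [e]
    constructor
    · intro ht
      refine tendsto_of_tendsto_quarticRisk hb hs₀ h3 (hG m hm) (hpos m hm) ?_
      simpa using ht.add hopt
    · intro ht
      simpa using (tendsto_quarticRisk_of_tendsto (hG m hm) ht).sub hopt
  · rw [isLittleO_rpow_neg_four_thirds_iff]
    -- By v = 4 b s₀³ the minimum is -(3/4) v s₀, and v s₀ = (v⁴/(4b))^{1/3}.
    have hval : quarticRisk v b (optScale v b)
        = -(3 / 4 * (v ^ 4 / (4 * b)) ^ (1 / 3 : ℝ)) := by
      have e : v ^ 4 / (4 * b) = v ^ 3 * (v / (4 * b)) := by field_simp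
      have e2 : (v ^ 3) ^ (1 / 3 : ℝ) = v := by
        rw [← Real.rpow_natCast, ← Real.rpow_mul hv.le]
        norm_num
      rw [e, Real.mul_rpow (by positivity) (by positivity), e2]
      change _ = -(3 / 4 * (v * optScale v b))
      unfold quarticRisk
      linear_combination (-(optScale v b) / 4) * h3
    have := hopt.sub_const (quarticRisk v b (optScale v b))
    rw [sub_self] at this
    refine this.congr' ?_
    filter_upwards [eventually_gt_atTop 0] with n hn
    have hq : (0 : ℝ) < ((n : ℝ) ^ (1 / 3 : ℝ)) ^ 4 := by positivity
    rw [hval, rpow_neg_four_thirds (Nat.cast_nonneg n)]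
    field_simp
    ring

/-- The optimal level is the unique minimiser of the leading terms. -/
theorem leading_optLevel_lt (hv : 0 < v) (hb : 0 < b) {n : ℕ} (hn : 0 < n) {m : ℝ} (hm : 0 < m)
    (hne : m ≠ optLevel v b n) :
    (n : ℝ)⁻¹ * σ - (n : ℝ)⁻¹ * optLevel v b n ^ (-(1 / 2) : ℝ) * v
        + optLevel v b n ^ (-2 : ℝ) * b
      < (n : ℝ)⁻¹ * σ - (n : ℝ)⁻¹ * m ^ (-(1 / 2) : ℝ) * v + m ^ (-2 : ℝ) * b := by
  have hs₀ := optScale_pos hv hb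
  have h3 := optScale_pow_three hv hb
  have e : ∀ l : ℝ, 0 < l → (n : ℝ)⁻¹ * σ - (n : ℝ)⁻¹ * l ^ (-(1 / 2) : ℝ) * v
      + l ^ (-2 : ℝ) * b = (n : ℝ)⁻¹ * σ
        + (((n : ℝ) ^ (1 / 3 : ℝ)) ^ 4)⁻¹ * quarticRisk v b (riskScale n l) := by
    intro l hl
    have hq : (0 : ℝ) < (n : ℝ) ^ (1 / 3 : ℝ) := by positivity
    have hq3 := rpow_third_pow n
    rw [rpow_neg_half hl, rpow_neg_two hl, quarticRisk, riskScale]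
    set q := (n : ℝ) ^ (1 / 3 : ℝ) with hqd
    have hs : 0 < √l := Real.sqrt_pos.2 hl
    have hs4 : √l ^ 4 = l ^ 2 := by
      rw [show 4 = 2 * 2 from rfl, pow_mul, Real.sq_sqrt hl.le]
    rw [div_pow, hs4, ← hq3]
    field_simp
    ring
  have hl := optLevel_pos hv hb hn
  rw [e _ hl, e _ hm, riskScale_optLevel hv hb hn]
  have hsc := riskScale_pos hn hm
  have hd : riskScale n m ≠ optScale v b := by
    intro h
    have := div_optLevel_eq hv hb hn hm
    rw [h, div_self hs₀.ne', one_pow, div_eq_one_iff_eq hl.ne'] at this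
    exact hne this
  have h5 := le_quarticRisk_sub hb hs₀ h3 hsc.le
  have h6 : 0 < 3 * b * optScale v b ^ 2 * (riskScale n m - optScale v b) ^ 2 := by
    have := sub_ne_zero.2 hd
    positivity
  have h7 : quarticRisk v b (optScale v b) < quarticRisk v b (riskScale n m) := by linarith
  gcongr

end Optimisation

end SzaszMirakyan

end

/-! ### Assembly of the theorem -/

theorem mainTheorem9 {d : ℕ} {Ω : Type*} [MeasurableSpace Ω]
    (P : Measure Ω) [IsProbabilityMeasure P]
    (μ : Measure (Fin d → ℝ)) [IsProbabilityMeasure μ]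
    (hsupp : ∀ᵐ x ∂μ, ∀ j, 0 ≤ x j)
    (X : ℕ → Ω → Fin d → ℝ)
    (hlaw : ∀ i, HasLaw (X i) μ P) (hindep : iIndepFun X P)
    (hF : SzaszMirakyan.InteriorC2 (SzaszMirakyan.jointCDF μ))
    (S : Set (Fin d → ℝ)) (hS : IsCompact S) (hSpos : S ⊆ SzaszMirakyan.openOrthant d) :
    let F : (Fin d → ℝ) → ℝ := SzaszMirakyan.jointCDF μ
    let imse : ℕ → ℝ → ℝ := fun n m =>
      SzaszMirakyan.IMSE P S F (SzaszMirakyan.estimator X (fun _ => m) n)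
    let Iσ : ℝ := ∫ x in S, SzaszMirakyan.sigmaSq F x
    let IV : ℝ := ∫ x in S, SzaszMirakyan.V F x
    let IB : ℝ := ∫ x in S, SzaszMirakyan.B F x ^ 2
    let mOpt : ℕ → ℝ := SzaszMirakyan.mOpt F S
    -- the expansion, as `n → ∞` and `m → ∞` independently
    (∃ r₁ r₂ : ℕ × ℝ → ℝ,
      (∀ (n : ℕ) (m : ℝ), 0 < n → 0 < m →
        imse n m = (n : ℝ)⁻¹ * Iσ - (n : ℝ)⁻¹ * m ^ (-(1 / 2) : ℝ) * IV + m ^ (-2 : ℝ) * IB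
          + r₁ (n, m) + r₂ (n, m)) ∧
      r₁ =o[atTop ×ˢ atTop] (fun p : ℕ × ℝ => (p.1 : ℝ)⁻¹ * p.2 ^ (-(1 / 2) : ℝ)) ∧
      r₂ =o[atTop ×ˢ atTop] (fun p : ℕ × ℝ => p.2 ^ (-2 : ℝ))) ∧
    -- the exact integrated MSE of the empirical distribution function
    (∀ n : ℕ, 0 < n →
      SzaszMirakyan.IMSE P S F (SzaszMirakyan.empiricalCDF X n) = (n : ℝ)⁻¹ * Iσ) ∧
    (0 < IB →
      0 < IV ∧
      -- `mOpt n` is the unique minimiser of the leading terms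
      (∀ n : ℕ, 0 < n → 0 < mOpt n ∧
        ∀ m : ℝ, 0 < m → m ≠ mOpt n →
          SzaszMirakyan.leadingIMSE F S n (mOpt n) < SzaszMirakyan.leadingIMSE F S n m) ∧
      -- no choice of `m → ∞` improves on `mOpt` at the order `n ^ (-4/3)`
      (∀ m : ℕ → ℝ, Tendsto m atTop atTop → ∀ ε > 0, ∀ᶠ n : ℕ in atTop,
        imse n (mOpt n) ≤ imse n (m n) + ε * (n : ℝ) ^ (-(4 / 3) : ℝ)) ∧
      -- a choice of `m → ∞` is as good as `mOpt` at that order iff it is equivalent to `mOpt`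
      (∀ m : ℕ → ℝ, Tendsto m atTop atTop →
        ((fun n : ℕ => imse n (m n) - imse n (mOpt n))
            =o[atTop] (fun n : ℕ => (n : ℝ) ^ (-(4 / 3) : ℝ)) ↔
          Tendsto (fun n : ℕ => m n / mOpt n) atTop (𝓝 1))) ∧
      -- the integrated MSE at `mOpt`
      (fun n : ℕ => imse n (mOpt n) -
          ((n : ℝ)⁻¹ * Iσ
            - (n : ℝ) ^ (-(4 / 3) : ℝ) * (3 / 4) * (IV ^ 4 / (4 * IB)) ^ (1 / 3 : ℝ)))
        =o[atTop] (fun n : ℕ => (n : ℝ) ^ (-(4 / 3) : ℝ))) := by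
  intro F imse Iσ IV IB mOpt
  have hFc : ContDiffOn ℝ 2 F (SzaszMirakyan.openOrthant d) := hF.contDiffOn
  have himse : ∀ (n : ℕ) (m : ℝ), 0 < n → 0 < m → imse n m
      = (n : ℝ)⁻¹ * SzaszMirakyan.varianceTerm μ S m + SzaszMirakyan.biasTerm μ S m :=
    fun n m hn hm => SzaszMirakyan.IMSE_estimator hlaw hindep hS hSpos hn hm
  have hA : ∀ ε > 0, ∀ᶠ m : ℝ in atTop,
      |SzaszMirakyan.varianceTerm μ S m - Iσ + IV / √m| ≤ ε / √m := fun ε hε =>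
    SzaszMirakyan.eventually_abs_varianceTerm_sub_le hFc hS hSpos hε
  have hC : ∀ ε > 0, ∀ᶠ m : ℝ in atTop,
      |SzaszMirakyan.biasTerm μ S m - IB / m ^ 2| ≤ ε / m ^ 2 := fun ε hε =>
    SzaszMirakyan.eventually_abs_biasTerm_sub_le hFc hS hSpos hε
  -- The remainders are n⁻¹ times the error of the variance term, and the error of the bias term.
  -- Both errors involve m alone, so the joint limits only require m to be large.
  refine ⟨⟨fun p => (p.1 : ℝ)⁻¹ * (SzaszMirakyan.varianceTerm μ S p.2 - Iσ + IV / √p.2),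
    fun p => SzaszMirakyan.biasTerm μ S p.2 - IB / p.2 ^ 2, ?_, ?_, ?_⟩, ?_, ?_⟩
  · intro n m hn hm
    rw [himse n m hn hm, SzaszMirakyan.rpow_neg_half hm, SzaszMirakyan.rpow_neg_two hm]
    ring
  · rw [isLittleO_iff]
    intro c hc
    filter_upwards [tendsto_snd.eventually (hA c hc),
      tendsto_snd.eventually (eventually_gt_atTop (0 : ℝ))] with p h1 h2
    rw [SzaszMirakyan.rpow_neg_half h2, norm_mul, norm_mul, mul_left_comm]
    refine mul_le_mul_of_nonneg_left ?_ (norm_nonneg _)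
    rw [Real.norm_eq_abs, Real.norm_of_nonneg (by positivity), mul_one_div]
    exact h1
  · rw [isLittleO_iff]
    intro c hc
    filter_upwards [tendsto_snd.eventually (hC c hc),
      tendsto_snd.eventually (eventually_gt_atTop (0 : ℝ))] with p h1 h2
    rw [SzaszMirakyan.rpow_neg_two h2, Real.norm_eq_abs, Real.norm_of_nonneg (by positivity),
      mul_one_div]
    exact h1
  · exact fun n hn => SzaszMirakyan.IMSE_empiricalCDF hlaw hindep hS hn
  · intro hIB
    have hIV : 0 < IV := SzaszMirakyan.integral_V_pos hFc hS hSpos hIB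
    obtain ⟨h1, h2, h3⟩ := SzaszMirakyan.optimal_tuning hIV hIB himse hA hC
    exact ⟨hIV, fun n hn => ⟨SzaszMirakyan.optLevel_pos hIV hIB hn, fun m hm hne =>
      SzaszMirakyan.leading_optLevel_lt hIV hIB hn hm hne⟩, h1, h2, h3⟩
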